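/- Let $-\infty\le c<0<d\le+\infty$ and $S=\{z\in\mathbb C: c<\operatorname{Re} z<d\}$. Let $\phi$ be a non-constant infinitely divisible probability law on $\mathbb R$, carried by $\mathbb Z$ and with minimal lattice $\mathbb Z$ (no $\gamma+\rho\mathbb Z$ with $\rho>1$ carries $\phi$), such that $\int e^{\theta y}\phi(dy)<\infty$ for all $\theta\in(c,d)$; let $\eta$ be its exponent on $S$, i.e. the holomorphic function on $S$, real on $(c,d)$, with $\int e^{zy}\phi(dy)=e^{\eta(z)}$. Let $(X_n)$ be $\mathbb Z$-valued random variables with $\mathbb E[e^{\theta X_n}]<\infty$ for $\theta\in(c,d)$, let $t_n\to+\infty$ be real numbers, and let $v\ge1$ be an integer. Assume that $(X_n)$ converges mod-$\phi$ on $S$ with parameters $(t_n)$, limiting function $\psi$ and speed $O(t_n^{-v})$: $\psi$ is analytic on $S$, does not vanish on $(c,d)$, $e^{-t_n\eta(z)}\mathbb E[e^{zX_n}]\to\psi(z)$ locally uniformly on $S$, and for each compact $K\subset S$ there is $C_K$ with $|e^{-t_n\eta(z)}\mathbb E[e^{zX_n}]-\psi(z)|\le C_Kt_n^{-v}$ for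 all $z\in K$ and all large $n$. Let $x\in(\eta'(0),\eta'(d))$, where $\eta'(d)=\lim_{\theta\uparrow d}\eta'(\theta)\in(-\infty,+\infty]$. Then there is exactly one $h\in(c,d)$ with $\eta'(h)=x$. Put $F(x)=\sup_{\theta\in\mathbb R}\{\theta x-\eta(\theta)\}$, where $\eta(\theta)=\log\int e^{\theta y}\phi(dy)\in(-\infty,+\infty]$ for real $\theta$. Let $g:\mathbb R_+\to\mathbb R$ satisfy $|g(y)|\le\bar a e^{\bar h y}$ for all $y\ge0$, with $\bar a>0$ and $\bar h<h$. Then the random variables $g(X_n-t_nx)1_{X_n\ge t_nx}$ are integrable, and as $n\to\infty$ along the $n$ with $t_nx\in\mathbb N=\{0,1,2,\dots\}$, $$\mathbb E\left[g(X_n-t_nx)1_{X_n\ge t_nx}\right]=\frac{e^{-t_nF(x)}}{\sqrt{2\pi t_n\eta''(h)}}\left(\hat c_0+\frac{\hat c_1}{t_n}+\dots+\frac{\hat c_{v-1}}{t_n^{v-1}}+O\left(\frac1{t_n^v}\right)\right).$$ Here, for $0\le k\le v-1$, $$\hat c_k=\sum_{m+\ell+n=2k}\ \sum_{q=0}^\infty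 g(q)e^{-qh}\frac{(-q)^m}{m!}\cdot\frac{\psi^{(\ell)}(h)}{\ell!}\cdot\sum_{(m_1,\dots,m_n)\in\mathcal S_n}\frac{(-1)^{M}}{m_1!\,1!^{m_1}\cdots m_n!\,n!^{m_n}}\prod_{j=1}^n\left(\frac1{\eta''(h)}\frac{\eta^{(j+2)}(h)}{(j+2)(j+1)}\right)^{m_j}\frac{(-1)^k(2(k+M)-1)!!}{(\eta''(h))^k},$$ where $m,\ell,n\ge0$ are integers, $M=m_1+\dots+m_n$, $\mathcal S_n$ is the set of tuples of natural numbers $(m_1,\dots,m_n)$ with $1\cdot m_1+2\cdot m_2+\dots+n\cdot m_n=n$ ($\mathcal S_0$ consists of the empty tuple), $(-1)!!=1$ and $(-q)^0=1$; all the series over $q$ converge absolutely. In particular $\hat c_0=\psi(h)\sum_{q=0}^\infty g(q)e^{-qh}$. -/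

import Mathlib

open MeasureTheory ProbabilityTheory Filter Topology

noncomputable section

namespace ModPhi

/-- The open vertical strip `{z : c < Re z < d}`, with `c`, `d` extended real numbers. -/
def strip (c d : EReal) : Set ℂ := {z : ℂ | c < (z.re : EReal) ∧ (z.re : EReal) < d}

/-- A probability law on the line is infinitely divisible if, for every `n ≥ 1`, it is the law of
the sum of `n` independent random variables with a common law. -/
def IsInfinitelyDivisible (φ : Measure ℝ) : Prop :=
  ∀ n : ℕ, 1 ≤ n → ∃ ν : Measure ℝ, IsProbabilityMeasure ν ∧
    (Measure.pi fun _ : Fin n => ν).map (fun y => ∑ i, y i) = φ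

/-- `φ` is a non-constant infinitely divisible probability law on the line, all of whose
exponential moments of order `θ ∈ (c, d)` are finite, and `η` is its exponent on the strip
`c < Re z < d`: the holomorphic function with `∫ exp (z y) φ(dy) = exp (η z)` that is real on
the real axis. (These conditions determine `η` on the strip.) -/
structure IsExponentOn (φ : Measure ℝ) (η : ℂ → ℂ) (c d : EReal) : Prop where
  isProbabilityMeasure : IsProbabilityMeasure φ
  infinitelyDivisible : IsInfinitelyDivisible φ
  nonconstant : ∀ a : ℝ, φ ≠ Measure.dirac a
  integrable : ∀ θ : ℝ, c < (θ : EReal) → (θ : EReal) < d →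
    Integrable (fun y : ℝ => Real.exp (θ * y)) φ
  holomorphic : DifferentiableOn ℂ η (strip c d)
  exp_eq : ∀ z ∈ strip c d, Complex.exp (η z) = ∫ y : ℝ, Complex.exp (z * (y : ℂ)) ∂φ
  real_on_real : ∀ θ : ℝ, c < (θ : EReal) → (θ : EReal) < d → (η (θ : ℂ)).im = 0

/-- The renormalised moment generating function `exp (-t_n η(z)) * E[exp (z X_n)]`. -/
def renormalized {Ω : Type*} [MeasurableSpace Ω] (P : Measure Ω) (X : ℕ → Ω → ℝ) (t : ℕ → ℝ)
    (η : ℂ → ℂ) (n : ℕ) (z : ℂ) : ℂ :=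
  Complex.exp (-((t n : ℂ) * η z)) * ∫ ω, Complex.exp (z * (X n ω : ℂ)) ∂P

/-- The random variables `X n` converge mod-`φ` on the strip `c < Re z < d`, with parameters `t n`
and limiting function `ψ`, where `η` is the exponent of `φ`. -/
structure ConvergesModPhi {Ω : Type*} [MeasurableSpace Ω] (P : Measure Ω) (X : ℕ → Ω → ℝ)
    (t : ℕ → ℝ) (φ : Measure ℝ) (η ψ : ℂ → ℂ) (c d : EReal) : Prop where
  exponent : IsExponentOn φ η c d
  integrable : ∀ n, ∀ θ : ℝ, c < (θ : EReal) → (θ : EReal) < d →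
    Integrable (fun ω => Real.exp (θ * X n ω)) P
  tendsto_param : Tendsto t atTop atTop
  analytic : AnalyticOnNhd ℂ ψ (strip c d)
  ne_zero : ∀ θ : ℝ, c < (θ : EReal) → (θ : EReal) < d → ψ (θ : ℂ) ≠ 0
  tendsto : TendstoLocallyUniformlyOn (renormalized P X t η) ψ atTop (strip c d)

/-- The convergence of the renormalised moment generating functions to `ψ` has speed
`O (t_n ^ (-v))`, uniformly on compact subsets of the strip. -/
def HasSpeed {Ω : Type*} [MeasurableSpace Ω] (P : Measure Ω) (X : ℕ → Ω → ℝ) (t : ℕ → ℝ)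
    (η ψ : ℂ → ℂ) (c d : EReal) (v : ℕ) : Prop :=
  ∀ K : Set ℂ, IsCompact K → K ⊆ strip c d → ∃ C : ℝ, 0 < C ∧
    ∀ᶠ n in atTop, ∀ z ∈ K, ‖renormalized P X t η n z - ψ z‖ ≤ C / t n ^ v

/-- `φ` is a lattice law with minimal lattice `ℤ`: it is carried by `ℤ`, and by no
`γ + ρ ℤ` with `ρ > 1`. -/
def HasMinimalLatticeInt (φ : Measure ℝ) : Prop :=
  (∀ᵐ y : ℝ ∂φ, ∃ k : ℤ, y = k) ∧
    ∀ γ ρ : ℝ, 1 < ρ → ¬ ∀ᵐ y : ℝ ∂φ, ∃ k : ℤ, y = γ + ρ * k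

/-- `η'(d)`: the limit, in the extended reals, of the real derivative `η'(θ)` as the real variable
`θ` increases to the (possibly infinite) right end `d`. For the exponent of a law, `η'` is
nondecreasing, so the upper limit below is a limit. -/
def derivAtRightEnd (η : ℂ → ℂ) (d : EReal) : EReal :=
  limsup (fun θ : ℝ => ((deriv η (θ : ℂ)).re : EReal)) (comap Real.toEReal (𝓝[<] d))

/-- `F(x) = sup_θ (θ x - η(θ))`, where `η(θ) = log ∫ exp (θ y) φ(dy)` for real `θ`. The points `θ`
with `η(θ) = +∞` do not contribute to the supremum and are left out. -/
def rateFunction (φ : Measure ℝ) (x : ℝ) : ℝ :=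
  ⨆ θ : {θ : ℝ // Integrable (fun y : ℝ => Real.exp (θ * y)) φ},
    ((θ : ℝ) * x - Real.log (∫ y : ℝ, Real.exp ((θ : ℝ) * y) ∂φ))

/-- The set of `(m_1, …, m_n)`, natural numbers with `1 m_1 + 2 m_2 + ⋯ + n m_n = n`; the entry
`m_j` is `m i` with `j = i + 1`. -/
def faaIndex (n : ℕ) : Finset (Fin n → ℕ) :=
  (Fintype.piFinset fun _ : Fin n => Finset.range (n + 1)).filter
    fun m => ∑ i : Fin n, ((i : ℕ) + 1) * m i = n

/-- The bound on the entries that makes `faaIndex` a finite set is automatic. -/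
theorem mem_faaIndex {n : ℕ} {m : Fin n → ℕ} :
    m ∈ faaIndex n ↔ ∑ i : Fin n, ((i : ℕ) + 1) * m i = n := by
  simp only [faaIndex, Finset.mem_filter, Fintype.mem_piFinset, Finset.mem_range,
    and_iff_right_iff_imp]
  intro h i
  have h1 : ((i : ℕ) + 1) * m i ≤ ∑ i : Fin n, ((i : ℕ) + 1) * m i :=
    Finset.single_le_sum (f := fun i : Fin n => ((i : ℕ) + 1) * m i)
      (fun _ _ => Nat.zero_le _) (Finset.mem_univ i)
  nlinarith [Nat.zero_le ((i : ℕ) * m i)]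

/-- The series `∑_{q ≥ 0} g(q) exp (-q h) (-q)^m / m!`. -/
def gSeries (g : ℝ → ℝ) (h : ℝ) (m : ℕ) : ℝ :=
  ∑' q : ℕ, g q * Real.exp (-(q * h)) * ((-(q : ℝ)) ^ m / (m.factorial : ℝ))

/-- The Faà di Bruno sum
`∑_{(m_1,…,m_n)} (-1)^M / (m_1! 1!^{m_1} ⋯ m_n! n!^{m_n})
  * ∏_j (η^{(j+2)}(h) / (η''(h) (j+2) (j+1)))^{m_j} * (-1)^k (2 (k + M) - 1)!! / η''(h)^k`
with `M = m_1 + ⋯ + m_n` and `(-1)!! = 1`. -/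
def faaSum (η : ℂ → ℂ) (h : ℝ) (k n : ℕ) : ℂ :=
  ∑ m ∈ faaIndex n,
    (-1) ^ (∑ i, m i) /
        (∏ i : Fin n, ((m i).factorial : ℂ) * (((i : ℕ) + 1).factorial : ℂ) ^ m i) *
      (∏ i : Fin n,
        (1 / iteratedDeriv 2 η h *
          (iteratedDeriv ((i : ℕ) + 3) η h / (((i : ℂ) + 3) * ((i : ℂ) + 2)))) ^ m i) *
      ((-1) ^ k * (Nat.doubleFactorial (2 * (k + ∑ i, m i) - 1) : ℂ) / iteratedDeriv 2 η h ^ k)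

/-- The coefficient `ĉ_k`: the sum over all `m + ℓ + n = 2 k` of
`gSeries g h m * ψ^{(ℓ)}(h) / ℓ! * faaSum η h k n`. -/
def coeff (η ψ : ℂ → ℂ) (g : ℝ → ℝ) (h : ℝ) (k : ℕ) : ℂ :=
  ∑ p ∈ Finset.HasAntidiagonal.antidiagonal (2 * k), ∑ r ∈ Finset.HasAntidiagonal.antidiagonal p.2,
    (gSeries g h p.1 : ℂ) * (iteratedDeriv r.1 ψ h / (r.1.factorial : ℂ)) * faaSum η h k r.2

/-- The tail functional `g(X_n - t_n x) 1_{X_n ≥ t_n x}`. -/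
def tail {Ω : Type*} (X : ℕ → Ω → ℝ) (t : ℕ → ℝ) (x : ℝ) (g : ℝ → ℝ) (n : ℕ) : Ω → ℝ :=
  Set.indicator {ω | t n * x ≤ X n ω} fun ω => g (X n ω - t n * x)

/-- The factor `exp (-s F(x)) / √(2 π s η''(h))`; the number `η''(h)` is real because `η` is real on
the real axis. -/
def prefactor (φ : Measure ℝ) (η : ℂ → ℂ) (x h s : ℝ) : ℝ :=
  Real.exp (-(s * rateFunction φ x)) / √(2 * Real.pi * s * (iteratedDeriv 2 η h).re)

end ModPhi

end

/-! The method is tilting at the saddle point `h`, exact Fourier inversion, then Laplace's method.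
On the real part of the strip `η` is the cumulant generating function of `φ`. It is strictly convex
there because `φ` is not constant. Hence `h` is unique, and the tangent inequality gives `F(x) = h x
- η(h)` (`rateFunction_eq`).

Put `G(s) = ∑ g(q) e^{-qh} e^{-qs}` (`lagSeries`). Since `X_n` is integer valued and `N = t_n x` is
an integer, orthogonality of the characters on `[-π, π]` turns the tail expectation into `(1/2π) ∫
G(iu) e^{-(h+iu)N} E[e^{(h+iu)X_n}] du` (`integral_lagSeries_mul_complexMGF`). With `Φ(s) = η(h+s) -
η(h) - x s` this is `e^{-t_n F(x)}/(2π)` times `∫ G(iu) ψ_n(h+iu) e^{t_n Φ(iu)} du`, where `ψ_n` is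
the renormalised generating function (`integral_tail_eq`).

Minimality of the lattice makes `Re Φ(iu)` negative for `0 < |u| ≤ π` (`re_lt_of_minimalLattice`),
and then `Re Φ(iu) ≤ -κ u²` by compactness. So replacing `ψ_n` by `ψ` costs `O(t_n^{-v})` times a
Gaussian integral of order `t_n^{-1/2}`.

For the remaining integral (`laplace_expansion`) write `Φ(s) = σ s²/2 + s² R(s)` with `R(0) = 0`, so
that `tΦ(iu) = -tσu²/2 - tu² R(iu)`. The factor `G(s) ψ(h+s) exp(-z R(s))` is Taylor expanded in `s`
with `z = tu²` frozen. Cauchy's estimates bound the remainder of order `2v` by `|u|^{2v}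
e^{-tσu²/4}`, whose integral has order `t^{-v-1/2}`. The polynomial part is integrated exactly: odd
terms vanish, terms of degree `2k` contribute `t^{-k}`, and Faà di Bruno's formula identifies their
coefficients with `ĉ_k`. -/

noncomputable section

namespace ModPhi

/-! ### Taylor coefficients and Cauchy estimates. -/

/-- The `n`-th Taylor coefficient at the origin. -/
def taylorCoeff (f : ℂ → ℂ) (n : ℕ) : ℂ := iteratedDeriv n f 0 / (n.factorial : ℂ)

theorem taylorCoeff_zero (f : ℂ → ℂ) : taylorCoeff f 0 = f 0 := by simp [taylorCoeff]

theorem taylorCoeff_mul {f g : ℂ → ℂ} (hf : AnalyticAt ℂ f 0) (hg : AnalyticAt ℂ g 0) (n : ℕ) :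
    taylorCoeff (f * g) n =
      ∑ p ∈ Finset.HasAntidiagonal.antidiagonal n, taylorCoeff f p.1 * taylorCoeff g p.2 := by
  rw [taylorCoeff, iteratedDeriv_mul hf.contDiffAt hg.contDiffAt, Finset.sum_div,
    ← Finset.Nat.sum_antidiagonal_eq_sum_range_succ
      (fun i j => (n.choose i : ℂ) * iteratedDeriv i f 0 * iteratedDeriv j g 0 / (n.factorial : ℂ))]
  refine Finset.sum_congr rfl fun p hp => ?_
  have hp' : p.1 + p.2 = n := Finset.HasAntidiagonal.mem_antidiagonal.mp hp
  subst hp'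
  have h := Nat.add_choose_mul_factorial_mul_factorial p.1 p.2
  rw [← Nat.choose_symm_add] at h
  have h' : ((p.1 + p.2).choose p.1 : ℂ) * (p.1.factorial : ℂ) * (p.2.factorial : ℂ) =
      ((p.1 + p.2).factorial : ℂ) := by exact_mod_cast h
  have h1 : (p.1.factorial : ℂ) ≠ 0 := by exact_mod_cast p.1.factorial_ne_zero
  have h2 : (p.2.factorial : ℂ) ≠ 0 := by exact_mod_cast p.2.factorial_ne_zero
  have h3 : ((p.1 + p.2).factorial : ℂ) ≠ 0 := by exact_mod_cast (p.1 + p.2).factorial_ne_zero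
  simp only [taylorCoeff]
  rw [div_mul_div_comm, div_eq_div_iff h3 (mul_ne_zero h1 h2), ← h']
  ring

theorem succ_mul_taylorCoeff_succ (f : ℂ → ℂ) (n : ℕ) :
    taylorCoeff f (n + 1) * (n + 1) = taylorCoeff (deriv f) n := by
  rw [taylorCoeff, taylorCoeff, iteratedDeriv_succ', Nat.factorial_succ]
  have h1 : (n.factorial : ℂ) ≠ 0 := by exact_mod_cast n.factorial_ne_zero
  have h2 : (n + 1 : ℂ) ≠ 0 := by exact_mod_cast n.succ_ne_zero
  push_cast
  field_simp

theorem taylorCoeff_congr {f g : ℂ → ℂ} (h : f =ᶠ[𝓝 0] g) (n : ℕ) :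
    taylorCoeff f n = taylorCoeff g n := by
  rw [taylorCoeff, taylorCoeff, h.iteratedDeriv_eq]

/-- A convergent power series is holomorphic, and its coefficients are its Taylor coefficients. -/
theorem hasFPowerSeriesOnBall_of_hasSum {f : ℂ → ℂ} {a : ℕ → ℂ} {r : ℝ} (hr : 0 < r)
    (h : ∀ s : ℂ, ‖s‖ < r → HasSum (fun n => a n * s ^ n) (f s)) :
    HasFPowerSeriesOnBall f (FormalMultilinearSeries.ofScalars ℂ a) 0 (ENNReal.ofReal r) where
  r_le := by
    refine ENNReal.le_of_forall_nnreal_lt fun ρ hρ => ?_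
    have hρ' : (ρ : ℝ) < r := by
      rwa [← ENNReal.ofReal_coe_nnreal, ENNReal.ofReal_lt_ofReal_iff hr] at hρ
    refine FormalMultilinearSeries.le_radius_of_summable_norm _ ?_
    have := (h (ρ : ℂ) (by simpa using hρ')).summable.norm
    simpa [FormalMultilinearSeries.ofScalars_norm] using this
  r_pos := by simpa using hr
  hasSum := by
    intro y hy
    have hy' : ‖y‖ < r := by
      rw [Metric.eball_ofReal] at hy
      simpa using hy
    simpa [FormalMultilinearSeries.ofScalars_apply_eq, smul_eq_mul, mul_comm] using h y hy'

theorem differentiableOn_of_hasSum {f : ℂ → ℂ} {a : ℕ → ℂ} {r : ℝ} (hr : 0 < r)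
    (h : ∀ s : ℂ, ‖s‖ < r → HasSum (fun n => a n * s ^ n) (f s)) :
    DifferentiableOn ℂ f (Metric.ball 0 r) := by
  have := (hasFPowerSeriesOnBall_of_hasSum hr h).differentiableOn
  rwa [Metric.eball_ofReal] at this

theorem taylorCoeff_of_hasSum {f : ℂ → ℂ} {a : ℕ → ℂ} {r : ℝ} (hr : 0 < r)
    (h : ∀ s : ℂ, ‖s‖ < r → HasSum (fun n => a n * s ^ n) (f s)) (n : ℕ) :
    taylorCoeff f n = a n := by
  have h1 := hasFPowerSeriesOnBall_of_hasSum hr h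
  have h2 := h1.analyticAt.hasFPowerSeriesAt
  have h3 := h1.hasFPowerSeriesAt.eq_formalMultilinearSeries h2
  have := congrArg (fun p => FormalMultilinearSeries.coeff p n) h3
  simpa [taylorCoeff] using this.symm

theorem hasSum_taylorCoeff {f : ℂ → ℂ} {r : ℝ} (hf : DifferentiableOn ℂ f (Metric.ball 0 r))
    {s : ℂ} (hs : ‖s‖ < r) : HasSum (fun n => taylorCoeff f n * s ^ n) (f s) := by
  have := Complex.hasSum_taylorSeries_on_ball hf (z := s) (by simpa using hs)
  convert! this using 2 with n
  rw [taylorCoeff, sub_zero, smul_eq_mul, smul_eq_mul]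
  ring

theorem norm_taylorCoeff_le {f : ℂ → ℂ} {r M : ℝ} (hr : 0 < r)
    (hf : DiffContOnCl ℂ f (Metric.ball 0 r)) (hM : ∀ z ∈ Metric.sphere (0 : ℂ) r, ‖f z‖ ≤ M)
    (n : ℕ) : ‖taylorCoeff f n‖ ≤ M / r ^ n := by
  have := Complex.norm_iteratedDeriv_le_of_forall_mem_sphere_norm_le n hr hf hM
  have h1 : (0 : ℝ) < n.factorial := by exact_mod_cast n.factorial_pos
  rw [taylorCoeff, norm_div, Complex.norm_natCast, div_le_iff₀ h1]
  linarith [mul_div_assoc (n.factorial : ℝ) M (r ^ n), mul_comm (n.factorial : ℝ) (M / r ^ n)]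

/-- Cauchy's bound for the remainder in Taylor's formula. -/
theorem norm_sub_sum_taylorCoeff_le {f : ℂ → ℂ} {r M : ℝ} (hr : 0 < r)
    (hf : DiffContOnCl ℂ f (Metric.ball 0 r)) (hM : ∀ z ∈ Metric.sphere (0 : ℂ) r, ‖f z‖ ≤ M)
    (N : ℕ) {s : ℂ} (hs : ‖s‖ ≤ r / 2) :
    ‖f s - ∑ n ∈ Finset.range N, taylorCoeff f n * s ^ n‖ ≤ 2 * M * (‖s‖ / r) ^ N := by
  have hsum := hasSum_taylorCoeff hf.differentiableOn (s := s) (by linarith)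
  have h1 := (hasSum_nat_add_iff' N).mpr hsum
  set ρ := ‖s‖ / r with hρ
  have hρ0 : 0 ≤ ρ := by positivity
  have hρ1 : ρ ≤ 1 / 2 := by rw [hρ, div_le_iff₀ hr]; linarith
  have hM0 : 0 ≤ M := (norm_nonneg _).trans (hM (r : ℂ) (by simp [hr.le]))
  have hg : HasSum (fun n : ℕ => M * ρ ^ N * ρ ^ n) (M * ρ ^ N * (1 - ρ)⁻¹) :=
    (hasSum_geometric_of_lt_one hρ0 (by linarith)).mul_left _
  have h2 : ‖f s - ∑ n ∈ Finset.range N, taylorCoeff f n * s ^ n‖ ≤ M * ρ ^ N * (1 - ρ)⁻¹ := by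
    rw [← h1.tsum_eq]
    refine tsum_of_norm_bounded hg fun n => ?_
    rw [norm_mul, norm_pow]
    calc ‖taylorCoeff f (n + N)‖ * ‖s‖ ^ (n + N) ≤ M / r ^ (n + N) * ‖s‖ ^ (n + N) := by
          gcongr; exact norm_taylorCoeff_le hr hf hM _
      _ = M * ρ ^ N * ρ ^ n := by rw [hρ, div_pow, div_pow]; field_simp; ring
  refine h2.trans ?_
  have : (1 - ρ)⁻¹ ≤ 2 := by
    rw [inv_le_comm₀ (by linarith) (by norm_num)]; linarith
  have h0 : 0 ≤ M * ρ ^ N := by positivity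
  nlinarith

/-! ### Faà di Bruno's formula for an exponential. -/

/-- The power series of `exp (b X ^ (i + 1))`. -/
def expMonomial (b : ℂ) (i : ℕ) : PowerSeries ℂ :=
  PowerSeries.mk fun k =>
    if (i + 1) ∣ k then b ^ (k / (i + 1)) / ((k / (i + 1)).factorial : ℂ) else 0

theorem derivative_expMonomial (b : ℂ) (i : ℕ) :
    PowerSeries.derivative ℂ (expMonomial b i) =
      PowerSeries.C ((i + 1 : ℂ) * b) * PowerSeries.X ^ i * expMonomial b i := by
  ext k
  rw [PowerSeries.coeff_derivative, mul_assoc, PowerSeries.coeff_C_mul, PowerSeries.coeff_X_pow_mul']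
  simp only [expMonomial, PowerSeries.coeff_mk]
  by_cases hk : i ≤ k
  · obtain ⟨l, rfl⟩ := Nat.exists_eq_add_of_le hk
    have e1 : i + l + 1 = l + (i + 1) := by ring
    have h1 : (i + 1) ∣ (i + l + 1) ↔ (i + 1) ∣ l := by
      rw [e1]; exact Nat.dvd_add_left (dvd_refl _)
    rw [if_pos hk, Nat.add_sub_cancel_left]
    by_cases hl : (i + 1) ∣ l
    · obtain ⟨q, rfl⟩ := hl
      rw [if_pos (h1.mpr (dvd_mul_right _ _)), if_pos (dvd_mul_right _ _)]
      have e2 : i + (i + 1) * q + 1 = (i + 1) * (q + 1) := by ring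
      rw [e2, Nat.mul_div_cancel_left _ i.succ_pos, Nat.mul_div_cancel_left _ i.succ_pos,
        Nat.factorial_succ]
      have h2 : (q.factorial : ℂ) ≠ 0 := by exact_mod_cast q.factorial_ne_zero
      have h3 : (q + 1 : ℂ) ≠ 0 := by exact_mod_cast q.succ_ne_zero
      push_cast
      field_simp
      ring
    · rw [if_neg (fun h => hl (h1.mp h)), if_neg hl]; ring
  · rw [if_neg hk, if_neg]
    · ring
    · intro h; exact absurd (Nat.le_of_dvd k.succ_pos h) (by omega)

theorem derivative_prod_expMonomial (b : ℕ → ℂ) (s : Finset ℕ) :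
    PowerSeries.derivative ℂ (∏ i ∈ s, expMonomial (b i) i) =
      (∑ i ∈ s, PowerSeries.C ((i + 1 : ℂ) * b i) * PowerSeries.X ^ i) *
        ∏ i ∈ s, expMonomial (b i) i := by
  induction s using Finset.induction_on with
  | empty => simp
  | insert i s hi ih =>
    rw [Finset.prod_insert hi, Finset.sum_insert hi, Derivation.leibniz, ih,
      derivative_expMonomial, smul_eq_mul, smul_eq_mul]
    ring

/-- Compare coefficients in `f' = (∑ (i+1) b_i X^i) f`. With the constant term, this recurrence
determines the coefficients, and the Taylor coefficients of `exp (z R)` satisfy it too. -/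
theorem succ_mul_coeff_prod_expMonomial (b : ℕ → ℂ) {N k : ℕ} (hk : k < N) :
    PowerSeries.coeff (k + 1) (∏ i ∈ Finset.range N, expMonomial (b i) i) * (k + 1) =
      ∑ p ∈ Finset.HasAntidiagonal.antidiagonal k, (p.1 + 1 : ℂ) * b p.1 *
        PowerSeries.coeff p.2 (∏ i ∈ Finset.range N, expMonomial (b i) i) := by
  rw [← PowerSeries.coeff_derivative, derivative_prod_expMonomial, PowerSeries.coeff_mul]
  refine Finset.sum_congr rfl fun p hp => ?_
  have hp' : p.1 + p.2 = k := Finset.HasAntidiagonal.mem_antidiagonal.mp hp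
  congr 1
  rw [map_sum, Finset.sum_eq_single p.1]
  · rw [PowerSeries.coeff_C_mul, PowerSeries.coeff_X_pow, if_pos rfl, mul_one]
  · intro i _ hi
    rw [PowerSeries.coeff_C_mul, PowerSeries.coeff_X_pow, if_neg (Ne.symm hi), mul_zero]
  · intro h; exact absurd (Finset.mem_range.mpr (by omega)) h

/-- A choice of exponents contributes only if the exponent taken from factor `i` is a multiple
`(i+1) m_i`; the total degree `n` is then the constraint defining `faaIndex n`. -/
theorem coeff_prod_expMonomial (b : ℕ → ℂ) (n : ℕ) :
    PowerSeries.coeff n (∏ i ∈ Finset.range n, expMonomial (b i) i) =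
      ∑ m ∈ faaIndex n, ∏ i : Fin n, b i ^ m i / ((m i).factorial : ℂ) := by
  rw [Finset.prod_range, PowerSeries.coeff_prod]
  symm
  refine Finset.sum_of_injOn
    (fun m => Finsupp.equivFunOnFinite.symm fun i : Fin n => ((i : ℕ) + 1) * m i) ?_ ?_ ?_ ?_
  · intro m _ m' _ h
    funext i
    have := DFunLike.congr_fun h i
    simpa using this
  · intro m hm
    have := mem_faaIndex.mp hm
    simp only [Finset.mem_coe, Finset.mem_finsuppAntidiag]
    exact ⟨by simpa using this, Finset.subset_univ _⟩
  · intro l hl hl'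
    rw [Finset.mem_finsuppAntidiag] at hl
    by_contra hne
    refine hl' ?_
    have hdvd : ∀ i : Fin n, ((i : ℕ) + 1) ∣ l i := by
      intro i
      by_contra hi
      refine hne (Finset.prod_eq_zero (Finset.mem_univ i) ?_)
      simp [expMonomial, hi]
    refine ⟨fun i => l i / ((i : ℕ) + 1), ?_, ?_⟩
    · rw [Finset.mem_coe, mem_faaIndex]
      refine Eq.trans ?_ hl.1
      exact Finset.sum_congr rfl fun i _ => Nat.mul_div_cancel' (hdvd i)
    · ext i
      simpa using Nat.mul_div_cancel' (hdvd i)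
  · intro m _
    refine Finset.prod_congr rfl fun i _ => ?_
    simp [expMonomial]

/-- Faà di Bruno's formula for the Taylor coefficients of the exponential of a function that
vanishes at the origin. -/
theorem taylorCoeff_exp {R : ℂ → ℂ} (hR : AnalyticAt ℂ R 0) (hR0 : R 0 = 0) (z : ℂ) (n : ℕ) :
    taylorCoeff (fun s => Complex.exp (z * R s)) n =
      ∑ m ∈ faaIndex n,
        ∏ i : Fin n, (z * taylorCoeff R (i + 1)) ^ m i / ((m i).factorial : ℂ) := by
  rw [← coeff_prod_expMonomial fun i => z * taylorCoeff R (i + 1)]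
  set f : ℂ → ℂ := fun s => Complex.exp (z * R s) with hf
  set g : ℂ → ℂ := fun s => z * deriv R s with hg
  have hfa : AnalyticAt ℂ f 0 := (analyticAt_const.mul hR).cexp
  have hga : AnalyticAt ℂ g 0 := analyticAt_const.mul hR.deriv
  have hderiv : deriv f =ᶠ[𝓝 0] g * f := by
    filter_upwards [hR.eventually_analyticAt] with s hs
    have := ((hs.differentiableAt.hasDerivAt.const_mul z).cexp).deriv
    simp only [hf, hg, Pi.mul_apply]
    rw [this]; ring
  have hgc : ∀ k, taylorCoeff g k = (k + 1 : ℂ) * (z * taylorCoeff R (k + 1)) := by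
    intro k
    have h1 : taylorCoeff g k = z * taylorCoeff (deriv R) k := by
      rw [taylorCoeff, taylorCoeff, hg, iteratedDeriv_const_mul_field, mul_div_assoc]
    rw [h1, ← succ_mul_taylorCoeff_succ]; ring
  -- The number of factors stays equal to `n` while `k` varies, so that the recurrence for index `k
  -- + 1 ≤ n` finds every factor it needs.
  suffices H : ∀ k ≤ n, taylorCoeff f k = PowerSeries.coeff k
      (∏ i ∈ Finset.range n, expMonomial (z * taylorCoeff R (i + 1)) i) from H n le_rfl
  intro k
  induction k using Nat.strong_induction_on with
  | _ k ih =>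
    intro hk
    rcases k with _ | k
    · rw [taylorCoeff_zero, PowerSeries.coeff_zero_eq_constantCoeff_apply, map_prod]
      simp [hf, hR0, expMonomial, ← PowerSeries.coeff_zero_eq_constantCoeff_apply]
    · have h2 : (k + 1 : ℂ) ≠ 0 := by exact_mod_cast k.succ_ne_zero
      refine mul_right_cancel₀ h2 ?_
      rw [succ_mul_coeff_prod_expMonomial (fun i => z * taylorCoeff R (i + 1)) hk,
        succ_mul_taylorCoeff_succ, taylorCoeff_congr hderiv, taylorCoeff_mul hga hfa]
      refine Finset.sum_congr rfl fun p hp => ?_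
      have hp' : p.1 + p.2 = k := Finset.HasAntidiagonal.mem_antidiagonal.mp hp
      rw [hgc, ih p.2 (by omega) (by omega)]

/-! ### Gaussian moments. -/

theorem integrable_pow_mul_exp_neg_mul_sq {b : ℝ} (hb : 0 < b) (n : ℕ) :
    Integrable fun u : ℝ => u ^ n * Real.exp (-(b * u ^ 2)) := by
  have := integrable_rpow_mul_exp_neg_mul_sq hb (s := n)
    (by have := n.cast_nonneg (α := ℝ); linarith)
  simpa [Real.rpow_natCast] using this

theorem integral_odd_pow_mul_exp_neg_mul_sq (b : ℝ) (k : ℕ) :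
    ∫ u : ℝ, u ^ (2 * k + 1) * Real.exp (-(b * u ^ 2)) = 0 := by
  have h := integral_neg_eq_self
    (fun u : ℝ => u ^ (2 * k + 1) * Real.exp (-(b * u ^ 2))) volume
  have h2 : ∀ u : ℝ, (-u) ^ (2 * k + 1) * Real.exp (-(b * (-u) ^ 2)) =
      -(u ^ (2 * k + 1) * Real.exp (-(b * u ^ 2))) := by
    intro u
    rw [Odd.neg_pow ⟨k, rfl⟩, neg_sq, neg_mul]
  simp only [h2, integral_neg] at h
  linarith

/-- The double factorial comes from the Gamma function at `k + 1/2`. For `k = 0` the truncated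
subtraction gives `0!! = 1`, which agrees with the convention `(-1)!! = 1`. -/
theorem integral_even_pow_mul_exp_neg_mul_sq {τ : ℝ} (hτ : 0 < τ) (k : ℕ) :
    ∫ u : ℝ, u ^ (2 * k) * Real.exp (-(τ / 2 * u ^ 2)) =
      √(2 * Real.pi / τ) * ((2 * k - 1).doubleFactorial : ℝ) / τ ^ k := by
  have h1 := integral_comp_abs (f := fun u : ℝ => u ^ (2 * k) * Real.exp (-(τ / 2 * u ^ 2)))
  simp only [pow_mul, sq_abs] at h1
  simp only [pow_mul]
  rw [h1]
  have h2 := integral_rpow_mul_exp_neg_mul_rpow (p := 2) (q := 2 * k) (b := τ / 2)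
    (by norm_num) (by have := k.cast_nonneg (α := ℝ); linarith) (by positivity)
  have h3 : ∫ u in Set.Ioi (0 : ℝ), (u ^ 2) ^ k * Real.exp (-(τ / 2 * u ^ 2)) =
      ∫ u in Set.Ioi (0 : ℝ), u ^ (2 * k : ℝ) * Real.exp (-(τ / 2) * u ^ (2 : ℝ)) := by
    refine setIntegral_congr_fun measurableSet_Ioi fun u _ => ?_
    have e1 : u ^ (2 * k : ℝ) = (u ^ 2) ^ k := by
      rw [← pow_mul, ← Real.rpow_natCast]; norm_cast
    have e2 : u ^ (2 : ℝ) = u ^ 2 := by norm_cast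
    simp only [e1, e2, neg_mul]
  rw [h3, h2]
  have e3 : ((2 * k : ℝ) + 1) / 2 = k + 1 / 2 := by ring
  have e4 : -((2 * k : ℝ) + 1) / 2 = -(k : ℝ) - 1 / 2 := by ring
  rw [e3, e4, Real.Gamma_nat_add_half, Real.rpow_sub (by positivity), Real.rpow_neg (by positivity),
    Real.rpow_natCast, ← Real.sqrt_eq_rpow]
  have e5 : √(2 * Real.pi / τ) = √Real.pi / √(τ / 2) := by
    rw [← Real.sqrt_div' _ (by positivity)]; congr 1; field_simp
  rw [e5, div_pow]
  have : √(τ / 2) ≠ 0 := by positivity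
  field_simp

/-- The moment of order `2k` of a centred Gaussian weight is homogeneous in the scale. -/
theorem integral_even_pow_mul_exp_neg_scale {κ t : ℝ} (hκ : 0 < κ) (ht : 0 < t) (k : ℕ) :
    ∫ u : ℝ, u ^ (2 * k) * Real.exp (-(t * κ * u ^ 2)) =
      √(2 * Real.pi / (2 * κ)) * ((2 * k - 1).doubleFactorial : ℝ) / (2 * κ) ^ k *
        (1 / (√t * t ^ k)) := by
  have h := integral_even_pow_mul_exp_neg_mul_sq (τ := t * (2 * κ)) (by positivity) k
  have e : t * (2 * κ) / 2 = t * κ := by ring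
  rw [e] at h
  rw [h, div_mul_eq_div_div_swap, Real.sqrt_div' _ ht.le, mul_pow]
  have : √t ≠ 0 := by positivity
  field_simp

/-! ### Pointwise Gaussian approximation of the integrand. -/

/-- The Gaussian polynomial that replaces `A (i u) exp (t Φ (i u))`, with `Φ s = σ s² / 2 + s² R s`,
in Laplace's method. -/
def gaussianApprox (A R : ℂ → ℂ) (σ : ℝ) (N : ℕ) (t u : ℝ) : ℂ :=
  (Real.exp (-(t * σ * u ^ 2 / 2)) : ℂ) * ∑ n ∈ Finset.range N,
    taylorCoeff (fun s => A s * Complex.exp (-((t * u ^ 2 : ℝ) : ℂ) * R s)) n *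
      ((u : ℂ) * Complex.I) ^ n

/-- The radius and `M` do not depend on `z`, which later equals `-t u²` and is unbounded. -/
theorem exists_radius_bound {A R : ℂ → ℂ} {r σ : ℝ} (hr : 0 < r) (hσ : 0 < σ)
    (hA : DifferentiableOn ℂ A (Metric.ball 0 r)) (hR : DifferentiableOn ℂ R (Metric.ball 0 r))
    (hR0 : R 0 = 0) :
    ∃ ρ M : ℝ, 0 < ρ ∧ ρ < r ∧ 0 ≤ M ∧ (∀ s : ℂ, ‖s‖ ≤ ρ → ‖R s‖ ≤ σ / 4) ∧
      ∀ z s : ℂ, ‖s‖ ≤ ρ → ‖A s * Complex.exp (z * R s)‖ ≤ M * Real.exp (‖z‖ * (σ / 4)) := by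
  have hRc : ContinuousAt R 0 := (hR.differentiableAt (Metric.ball_mem_nhds 0 hr)).continuousAt
  have hev : ∀ᶠ s in 𝓝 (0 : ℂ), ‖R s‖ < σ / 4 := by
    have h := hRc.norm
    rw [ContinuousAt, hR0, norm_zero] at h
    exact h.eventually (gt_mem_nhds (by positivity))
  obtain ⟨δ, hδ, hδR⟩ := Metric.eventually_nhds_iff_ball.mp hev
  refine ⟨min (δ / 2) (r / 2), ?_⟩
  set ρ := min (δ / 2) (r / 2) with hρ
  have hρ0 : 0 < ρ := lt_min (by positivity) (by positivity)
  have hρδ : ρ < δ := (min_le_left _ _).trans_lt (by linarith)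
  have hρr : ρ < r := (min_le_right _ _).trans_lt (by linarith)
  have hsub : Metric.closedBall (0 : ℂ) ρ ⊆ Metric.ball 0 r := Metric.closedBall_subset_ball hρr
  obtain ⟨M, hM⟩ := (isCompact_closedBall (0 : ℂ) ρ).exists_bound_of_continuousOn
    (hA.continuousOn.mono hsub)
  have hM0 : 0 ≤ M := (norm_nonneg _).trans (hM 0 (by simp [hρ0.le]))
  have hRb : ∀ s : ℂ, ‖s‖ ≤ ρ → ‖R s‖ ≤ σ / 4 := fun s hs =>
    (hδR s (by simpa using hs.trans_lt hρδ)).le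
  refine ⟨M, hρ0, hρr, hM0, hRb, fun z s hs => ?_⟩
  rw [norm_mul]
  refine mul_le_mul (hM s (by simpa using hs)) ?_ (norm_nonneg _) hM0
  refine (Complex.norm_exp_le_exp_norm _).trans (Real.exp_le_exp.mpr ?_)
  rw [norm_mul]
  exact mul_le_mul_of_nonneg_left (hRb s hs) (norm_nonneg _)

/-- Cauchy's estimates for `A exp (z R)` with `z = -t u²` cost a factor `exp (t u² σ/4)`. The weight
`exp (-t σ u²/2)` absorbs it and leaves `exp (-t σ u²/4)`, uniformly in `t`. -/
theorem norm_exp_sub_gaussianApprox_le {A R : ℂ → ℂ} {r σ : ℝ} (hr : 0 < r) (hσ : 0 < σ)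
    (hA : DifferentiableOn ℂ A (Metric.ball 0 r)) (hR : DifferentiableOn ℂ R (Metric.ball 0 r))
    (hR0 : R 0 = 0) (N : ℕ) :
    ∃ ρ C : ℝ, 0 < ρ ∧ ρ < r ∧ 0 ≤ C ∧ (∀ s : ℂ, ‖s‖ ≤ ρ → ‖R s‖ ≤ σ / 4) ∧
      ∀ t u : ℝ, 0 ≤ t →
        (|u| ≤ ρ → ‖A (u * Complex.I) * Complex.exp (t * (σ / 2 * (u * Complex.I) ^ 2 +
            (u * Complex.I) ^ 2 * R (u * Complex.I))) - gaussianApprox A R σ N t u‖ ≤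
          C * |u| ^ N * Real.exp (-(t * (σ / 4) * u ^ 2))) ∧
        (ρ ≤ |u| → ‖gaussianApprox A R σ N t u‖ ≤
          C * |u| ^ N * Real.exp (-(t * (σ / 4) * u ^ 2))) := by
  obtain ⟨ρ, M, hρ, hρr, hM, hRb, hAb⟩ := exists_radius_bound hr hσ hA hR hR0
  have hdiff : ∀ z : ℂ,
      DiffContOnCl ℂ (fun s => A s * Complex.exp (z * R s)) (Metric.ball 0 ρ) := by
    intro z
    refine DifferentiableOn.diffContOnCl_ball (U := Metric.ball 0 r) ?_
      (Metric.closedBall_subset_ball hρr)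
    exact hA.mul (hR.const_mul z).cexp
  have hC : 0 ≤ N * 2 ^ N * M / ρ ^ N := by positivity
  have hC' : 0 ≤ 2 * M / ρ ^ N := by positivity
  -- Half the Cauchy radius serves both regimes: for `|u| ≤ ρ/2` the Taylor remainder is a geometric
  -- tail of ratio at most `1/2`; for `|u| ≥ ρ/2` one has `2|u|/ρ ≥ 1`, so each of the `N` terms is
  -- at most `M' (2|u|/ρ)^N`.
  refine ⟨ρ / 2, 2 * M / ρ ^ N + N * 2 ^ N * M / ρ ^ N, by positivity, by linarith,
    by positivity, fun s hs => hRb s (by linarith), fun t u ht => ?_⟩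
  set z : ℂ := -((t * u ^ 2 : ℝ) : ℂ) with hz
  have hzn : ‖z‖ = t * u ^ 2 := by
    rw [hz, norm_neg, Complex.norm_real, Real.norm_of_nonneg (by positivity)]
  set M' := M * Real.exp (‖z‖ * (σ / 4)) with hM'
  have hsph : ∀ s ∈ Metric.sphere (0 : ℂ) ρ, ‖A s * Complex.exp (z * R s)‖ ≤ M' := by
    intro s hs
    exact hAb z s (by simpa using (mem_sphere_zero_iff_norm.mp hs).le)
  have hun : ‖(u : ℂ) * Complex.I‖ = |u| := by simp
  have hexp : Real.exp (-(t * σ * u ^ 2 / 2)) * M' =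
      M * Real.exp (-(t * (σ / 4) * u ^ 2)) := by
    rw [hM', mul_left_comm, ← Real.exp_add, hzn]; congr 2; ring
  have hX : 0 ≤ |u| ^ N * Real.exp (-(t * (σ / 4) * u ^ 2)) := by positivity
  constructor
  · intro hu
    have h1 := norm_sub_sum_taylorCoeff_le hρ (hdiff z) hsph N (s := u * Complex.I)
      (by rw [hun]; exact hu)
    have h2 : A (u * Complex.I) * Complex.exp (t * (σ / 2 * (u * Complex.I) ^ 2 +
            (u * Complex.I) ^ 2 * R (u * Complex.I))) =
        (Real.exp (-(t * σ * u ^ 2 / 2)) : ℂ) *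
          (A (u * Complex.I) * Complex.exp (z * R (u * Complex.I))) := by
      rw [mul_left_comm, Complex.ofReal_exp, ← Complex.exp_add]
      congr 2
      rw [hz, mul_pow, Complex.I_sq]
      push_cast
      ring
    rw [h2, gaussianApprox, ← mul_sub, norm_mul, Complex.norm_real,
      Real.norm_of_nonneg (Real.exp_pos _).le]
    refine (mul_le_mul_of_nonneg_left h1 (Real.exp_pos _).le).trans ?_
    rw [hun, div_pow]
    calc Real.exp (-(t * σ * u ^ 2 / 2)) * (2 * M' * (|u| ^ N / ρ ^ N))
        = (Real.exp (-(t * σ * u ^ 2 / 2)) * M') * (2 * (|u| ^ N / ρ ^ N)) := by ring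
      _ = 2 * M / ρ ^ N * (|u| ^ N * Real.exp (-(t * (σ / 4) * u ^ 2))) := by rw [hexp]; ring
      _ ≤ _ := by
        rw [mul_assoc (_ + _)]
        exact mul_le_mul_of_nonneg_right (by linarith) hX
  · intro hu
    rw [gaussianApprox, norm_mul, Complex.norm_real, Real.norm_of_nonneg (Real.exp_pos _).le]
    have hw : 1 ≤ 2 * (|u| / ρ) := by
      rw [← mul_div_assoc, le_div_iff₀ hρ]; linarith
    have h1 : ‖∑ n ∈ Finset.range N, taylorCoeff (fun s => A s * Complex.exp (z * R s)) n *
        ((u : ℂ) * Complex.I) ^ n‖ ≤ ∑ n ∈ Finset.range N, M' * (2 ^ N * (|u| / ρ) ^ N) := by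
      refine norm_sum_le_of_le _ fun n hn => ?_
      rw [norm_mul, norm_pow, hun]
      have h2 := norm_taylorCoeff_le hρ (hdiff z) hsph n
      have hM'0 : 0 ≤ M' := by positivity
      calc _ ≤ M' / ρ ^ n * |u| ^ n := by gcongr
        _ = M' * (1 * (|u| / ρ) ^ n) := by rw [div_pow]; ring
        _ ≤ M' * (2 ^ n * (|u| / ρ) ^ n) := by
          gcongr; exact one_le_pow₀ (by norm_num)
        _ = M' * (2 * (|u| / ρ)) ^ n := by rw [mul_pow]
        _ ≤ M' * (2 * (|u| / ρ)) ^ N := by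
          exact mul_le_mul_of_nonneg_left
            (pow_le_pow_right₀ hw (Finset.mem_range.mp hn).le) hM'0
        _ = _ := by rw [mul_pow]
    refine (mul_le_mul_of_nonneg_left h1 (Real.exp_pos _).le).trans ?_
    rw [Finset.sum_const, Finset.card_range, nsmul_eq_mul]
    calc Real.exp (-(t * σ * u ^ 2 / 2)) * (N * (M' * (2 ^ N * (|u| / ρ) ^ N)))
        = (Real.exp (-(t * σ * u ^ 2 / 2)) * M') * (N * (2 ^ N * (|u| / ρ) ^ N)) := by ring
      _ = N * 2 ^ N * M / ρ ^ N * (|u| ^ N * Real.exp (-(t * (σ / 4) * u ^ 2))) := by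
        rw [hexp, div_pow]; ring
      _ ≤ _ := by
        rw [mul_assoc (_ + _)]
        exact mul_le_mul_of_nonneg_right (by linarith) hX

/-! ### Exact integration of the Gaussian approximation. -/

/-- The sum over `faaIndex n` that arises when the Taylor coefficients of an exponential are
integrated against a Gaussian weight of inverse variance `σ`. -/
def gaussianFaaSum (σ : ℂ) (a : ℕ → ℂ) (k n : ℕ) : ℂ :=
  ∑ m ∈ faaIndex n, (∏ i : Fin n, a i ^ m i / ((m i).factorial : ℂ)) * (-1) ^ (∑ i, m i) *
    ((-1) ^ k * (Nat.doubleFactorial (2 * (k + ∑ i, m i) - 1) : ℂ) / σ ^ (k + ∑ i, m i))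

/-- The `n`-th summand of `gaussianApprox`. -/
def gaussianTerm (A R : ℂ → ℂ) (σ : ℝ) (t : ℝ) (n : ℕ) (u : ℝ) : ℂ :=
  (Real.exp (-(t * σ * u ^ 2 / 2)) : ℂ) *
    (taylorCoeff (fun s => A s * Complex.exp (-((t * u ^ 2 : ℝ) : ℂ) * R s)) n *
      ((u : ℂ) * Complex.I) ^ n)

theorem gaussianApprox_eq_sum (A R : ℂ → ℂ) (σ : ℝ) (N : ℕ) (t u : ℝ) :
    gaussianApprox A R σ N t u = ∑ n ∈ Finset.range N, gaussianTerm A R σ t n u := by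
  simp only [gaussianApprox, gaussianTerm, Finset.mul_sum]

variable {G Ψ R : ℂ → ℂ}

theorem taylorCoeff_mul_exp (hG : AnalyticAt ℂ G 0) (hΨ : AnalyticAt ℂ Ψ 0)
    (hR : AnalyticAt ℂ R 0) (hR0 : R 0 = 0) (z : ℂ) (n : ℕ) :
    taylorCoeff (fun s => G s * Ψ s * Complex.exp (z * R s)) n =
      ∑ p ∈ Finset.HasAntidiagonal.antidiagonal n,
        ∑ r ∈ Finset.HasAntidiagonal.antidiagonal p.2, ∑ m ∈ faaIndex r.2,
          taylorCoeff G p.1 * taylorCoeff Ψ r.1 *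
            (z ^ (∑ i, m i) *
              ∏ i : Fin r.2, taylorCoeff R (i + 1) ^ m i / ((m i).factorial : ℂ)) := by
  have hE : AnalyticAt ℂ (fun s => Complex.exp (z * R s)) 0 := (analyticAt_const.mul hR).cexp
  have h1 : (fun s => G s * Ψ s * Complex.exp (z * R s)) =
      G * (Ψ * fun s => Complex.exp (z * R s)) := by
    funext s; simp [mul_assoc]
  rw [h1, taylorCoeff_mul hG (hΨ.mul hE)]
  refine Finset.sum_congr rfl fun p _ => ?_
  rw [taylorCoeff_mul hΨ hE, Finset.mul_sum]
  refine Finset.sum_congr rfl fun r _ => ?_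
  rw [taylorCoeff_exp hR hR0, Finset.mul_sum, Finset.mul_sum]
  refine Finset.sum_congr rfl fun m _ => ?_
  rw [← mul_assoc, ← Finset.prod_pow_eq_pow_sum, ← Finset.prod_mul_distrib]
  congr 1
  refine Finset.prod_congr rfl fun i _ => ?_
  rw [mul_pow, mul_div_assoc]

theorem gaussianTerm_eq (hG : AnalyticAt ℂ G 0) (hΨ : AnalyticAt ℂ Ψ 0)
    (hR : AnalyticAt ℂ R 0) (hR0 : R 0 = 0) (σ t : ℝ) (n : ℕ) (u : ℝ) :
    gaussianTerm (fun s => G s * Ψ s) R σ t n u =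
      ∑ p ∈ Finset.HasAntidiagonal.antidiagonal n,
        ∑ r ∈ Finset.HasAntidiagonal.antidiagonal p.2, ∑ m ∈ faaIndex r.2,
          taylorCoeff G p.1 * taylorCoeff Ψ r.1 *
            (((-1) ^ (∑ i, m i) * (t : ℂ) ^ (∑ i, m i) * Complex.I ^ n) *
              ∏ i : Fin r.2, taylorCoeff R (i + 1) ^ m i / ((m i).factorial : ℂ)) *
          ((u ^ (n + 2 * ∑ i, m i) * Real.exp (-(t * σ / 2 * u ^ 2)) : ℝ) : ℂ) := by
  rw [gaussianTerm, taylorCoeff_mul_exp hG hΨ hR hR0, Finset.sum_mul, Finset.mul_sum]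
  refine Finset.sum_congr rfl fun p _ => ?_
  rw [Finset.sum_mul, Finset.mul_sum]
  refine Finset.sum_congr rfl fun r _ => ?_
  rw [Finset.sum_mul, Finset.mul_sum]
  refine Finset.sum_congr rfl fun m _ => ?_
  have e : t * σ * u ^ 2 / 2 = t * σ / 2 * u ^ 2 := by ring
  rw [e]
  push_cast
  rw [neg_eq_neg_one_mul ((t : ℂ) * (u : ℂ) ^ 2), mul_pow, mul_pow, mul_pow, ← pow_mul, pow_add]
  ring

theorem integrable_gaussianTerm (hG : AnalyticAt ℂ G 0) (hΨ : AnalyticAt ℂ Ψ 0)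
    (hR : AnalyticAt ℂ R 0) (hR0 : R 0 = 0) {σ t : ℝ} (hσ : 0 < σ) (ht : 0 < t) (n : ℕ) :
    Integrable (gaussianTerm (fun s => G s * Ψ s) R σ t n) := by
  have h := funext (gaussianTerm_eq hG hΨ hR hR0 σ t n)
  rw [h]
  refine integrable_finsetSum _ fun p _ => integrable_finsetSum _ fun r _ =>
    integrable_finsetSum _ fun m _ => Integrable.const_mul ?_ _
  exact (integrable_pow_mul_exp_neg_mul_sq (by positivity) _).ofReal

theorem integral_gaussianTerm (hG : AnalyticAt ℂ G 0) (hΨ : AnalyticAt ℂ Ψ 0)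
    (hR : AnalyticAt ℂ R 0) (hR0 : R 0 = 0) {σ t : ℝ} (hσ : 0 < σ) (ht : 0 < t) (n : ℕ) :
    ∫ u, gaussianTerm (fun s => G s * Ψ s) R σ t n u =
      ∑ p ∈ Finset.HasAntidiagonal.antidiagonal n,
        ∑ r ∈ Finset.HasAntidiagonal.antidiagonal p.2, ∑ m ∈ faaIndex r.2,
          taylorCoeff G p.1 * taylorCoeff Ψ r.1 *
            (((-1) ^ (∑ i, m i) * (t : ℂ) ^ (∑ i, m i) * Complex.I ^ n) *
              ∏ i : Fin r.2, taylorCoeff R (i + 1) ^ m i / ((m i).factorial : ℂ)) *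
          ((∫ u : ℝ, u ^ (n + 2 * ∑ i, m i) * Real.exp (-(t * σ / 2 * u ^ 2)) : ℝ) : ℂ) := by
  have hint : ∀ l : ℕ, ∀ c : ℂ, Integrable fun u : ℝ =>
      c * ((u ^ l * Real.exp (-(t * σ / 2 * u ^ 2)) : ℝ) : ℂ) := fun l c =>
    ((integrable_pow_mul_exp_neg_mul_sq (by positivity) l).ofReal).const_mul c
  simp only [gaussianTerm_eq hG hΨ hR hR0]
  rw [integral_finsetSum _ fun p _ => integrable_finsetSum _ fun r _ =>
    integrable_finsetSum _ fun m _ => hint _ _]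
  refine Finset.sum_congr rfl fun p _ => ?_
  rw [integral_finsetSum _ fun r _ => integrable_finsetSum _ fun m _ => hint _ _]
  refine Finset.sum_congr rfl fun r _ => ?_
  rw [integral_finsetSum _ fun m _ => hint _ _]
  refine Finset.sum_congr rfl fun m _ => ?_
  rw [integral_const_mul, integral_complex_ofReal]

theorem integral_gaussianTerm_odd (hG : AnalyticAt ℂ G 0) (hΨ : AnalyticAt ℂ Ψ 0)
    (hR : AnalyticAt ℂ R 0) (hR0 : R 0 = 0) {σ t : ℝ} (hσ : 0 < σ) (ht : 0 < t) (k : ℕ) :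
    ∫ u, gaussianTerm (fun s => G s * Ψ s) R σ t (2 * k + 1) u = 0 := by
  rw [integral_gaussianTerm hG hΨ hR hR0 hσ ht]
  refine Finset.sum_eq_zero fun p _ => Finset.sum_eq_zero fun r _ => Finset.sum_eq_zero fun m _ => ?_
  have e : 2 * k + 1 + 2 * ∑ i, m i = 2 * (k + ∑ i, m i) + 1 := by ring
  rw [e, integral_odd_pow_mul_exp_neg_mul_sq]
  simp

/-- With `M = ∑ m_i`, the power `(t u²)^M` from the exponential raises the moment to order `2(k+M)`,
which equals `√(2π/(tσ)) (2(k+M)-1)!! / (tσ)^(k+M)`. The factor `t^M` cancels and `t^(-k)` remains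
whatever `M` is. -/
theorem integral_gaussianTerm_even (hG : AnalyticAt ℂ G 0) (hΨ : AnalyticAt ℂ Ψ 0)
    (hR : AnalyticAt ℂ R 0) (hR0 : R 0 = 0) {σ t : ℝ} (hσ : 0 < σ) (ht : 0 < t) (k : ℕ) :
    ∫ u, gaussianTerm (fun s => G s * Ψ s) R σ t (2 * k) u =
      (√(2 * Real.pi / (t * σ)) : ℂ) *
        ((∑ p ∈ Finset.HasAntidiagonal.antidiagonal (2 * k),
          ∑ r ∈ Finset.HasAntidiagonal.antidiagonal p.2, taylorCoeff G p.1 * taylorCoeff Ψ r.1 *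
            gaussianFaaSum σ (fun i => taylorCoeff R (i + 1)) k r.2) / (t : ℂ) ^ k) := by
  rw [integral_gaussianTerm hG hΨ hR hR0 hσ ht, Finset.sum_div, Finset.mul_sum]
  refine Finset.sum_congr rfl fun p _ => ?_
  rw [Finset.sum_div, Finset.mul_sum]
  refine Finset.sum_congr rfl fun r _ => ?_
  rw [gaussianFaaSum, Finset.mul_sum, Finset.sum_div, Finset.mul_sum]
  refine Finset.sum_congr rfl fun m _ => ?_
  have e : 2 * k + 2 * ∑ i, m i = 2 * (k + ∑ i, m i) := by ring
  have hI : Complex.I ^ (2 * k) = (-1) ^ k := by rw [pow_mul, Complex.I_sq]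
  rw [e, integral_even_pow_mul_exp_neg_mul_sq (by positivity : 0 < t * σ), hI]
  have ht' : (t : ℂ) ≠ 0 := by exact_mod_cast ht.ne'
  have hσ' : (σ : ℂ) ≠ 0 := by exact_mod_cast hσ.ne'
  push_cast
  generalize (∏ i : Fin r.2, taylorCoeff R (i + 1) ^ m i / ((m i).factorial : ℂ)) = w
  rw [mul_pow, pow_add (t : ℂ)]
  field_simp

theorem sum_range_two_mul {M : Type*} [AddCommMonoid M] (f : ℕ → M) (v : ℕ) :
    ∑ n ∈ Finset.range (2 * v), f n = ∑ k ∈ Finset.range v, (f (2 * k) + f (2 * k + 1)) := by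
  induction v with
  | zero => simp
  | succ v ih =>
    rw [show 2 * (v + 1) = 2 * v + 1 + 1 by ring, Finset.sum_range_succ, Finset.sum_range_succ,
      ih, Finset.sum_range_succ, add_assoc]

theorem integrable_gaussianApprox (hG : AnalyticAt ℂ G 0) (hΨ : AnalyticAt ℂ Ψ 0)
    (hR : AnalyticAt ℂ R 0) (hR0 : R 0 = 0) {σ t : ℝ} (hσ : 0 < σ) (ht : 0 < t) (N : ℕ) :
    Integrable (gaussianApprox (fun s => G s * Ψ s) R σ N t) := by
  rw [funext (gaussianApprox_eq_sum (fun s => G s * Ψ s) R σ N t)]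
  exact integrable_finsetSum _ fun n _ => integrable_gaussianTerm hG hΨ hR hR0 hσ ht n

theorem integral_gaussianApprox (hG : AnalyticAt ℂ G 0) (hΨ : AnalyticAt ℂ Ψ 0)
    (hR : AnalyticAt ℂ R 0) (hR0 : R 0 = 0) {σ t : ℝ} (hσ : 0 < σ) (ht : 0 < t) (v : ℕ) :
    ∫ u, gaussianApprox (fun s => G s * Ψ s) R σ (2 * v) t u =
      (√(2 * Real.pi / (t * σ)) : ℂ) * ∑ k ∈ Finset.range v,
        (∑ p ∈ Finset.HasAntidiagonal.antidiagonal (2 * k),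
          ∑ r ∈ Finset.HasAntidiagonal.antidiagonal p.2, taylorCoeff G p.1 * taylorCoeff Ψ r.1 *
            gaussianFaaSum σ (fun i => taylorCoeff R (i + 1)) k r.2) / (t : ℂ) ^ k := by
  simp only [gaussianApprox_eq_sum]
  rw [integral_finsetSum _ fun n _ => integrable_gaussianTerm hG hΨ hR hR0 hσ ht n,
    sum_range_two_mul, Finset.mul_sum]
  refine Finset.sum_congr rfl fun k _ => ?_
  rw [integral_gaussianTerm_odd hG hΨ hR hR0 hσ ht, add_zero,
    integral_gaussianTerm_even hG hΨ hR hR0 hσ ht]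

/-! ### The phase and Laplace's method. -/

/-- Second order Taylor expansion of a phase with a nondegenerate critical point at the origin. -/
theorem exists_quadratic_remainder {Φ : ℂ → ℂ} {r : ℝ} {σ : ℂ} (hr : 0 < r)
    (hΦ : DifferentiableOn ℂ Φ (Metric.ball 0 r)) (h0 : taylorCoeff Φ 0 = 0)
    (h1 : taylorCoeff Φ 1 = 0) (h2 : taylorCoeff Φ 2 = σ / 2) :
    ∃ R : ℂ → ℂ, DifferentiableOn ℂ R (Metric.ball 0 r) ∧ R 0 = 0 ∧
      (∀ s, Φ s = σ / 2 * s ^ 2 + s ^ 2 * R s) ∧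
      ∀ n, taylorCoeff R (n + 1) = taylorCoeff Φ (n + 3) := by
  set R : ℂ → ℂ := fun s => if s = 0 then 0 else (Φ s - σ / 2 * s ^ 2) / s ^ 2 with hRdef
  have hΦ0 : Φ 0 = 0 := by rw [← taylorCoeff_zero Φ, h0]
  -- The series of `R` is that of `Φ` shifted by two; its constant term is zero because `σ/2` has
  -- been subtracted.
  set a : ℕ → ℂ := fun n => if n = 0 then 0 else taylorCoeff Φ (n + 2) with ha
  have hsum : ∀ s : ℂ, ‖s‖ < r → HasSum (fun n => a n * s ^ n) (R s) := by
    intro s hs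
    by_cases hs0 : s = 0
    · subst hs0
      have hz : (fun n => a n * (0 : ℂ) ^ n) = fun _ => 0 := by
        funext n; rcases n with _ | n <;> simp [ha]
      rw [hz]
      simp [hRdef]
    · have h3 := (hasSum_nat_add_iff' 3).mpr (hasSum_taylorCoeff hΦ hs)
      rw [Finset.sum_range_succ, Finset.sum_range_succ, Finset.sum_range_one, h0, h1, h2] at h3
      rw [← hasSum_nat_add_iff' 1]
      have h4 := h3.div_const (s ^ 2)
      convert! h4 using 1
      · funext n
        simp only [ha, Nat.add_eq_zero_iff, one_ne_zero, and_false, if_false]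
        field_simp
        ring
      · simp [hRdef, hs0, ha]
  refine ⟨R, differentiableOn_of_hasSum hr hsum, by simp [hRdef], fun s => ?_, fun n => ?_⟩
  · by_cases hs0 : s = 0
    · simp [hs0, hΦ0]
    · simp only [hRdef, if_neg hs0]; field_simp; ring
  · rw [taylorCoeff_of_hasSum hr hsum]; simp [ha]

/-- Near the origin `|R| ≤ σ/4` leaves at least half of the quadratic decay. On `ρ ≤ |u| ≤ L` the
real part has a negative maximum `-m`, and `m ≥ (m/L²) u²`. The condition `κ ≤ σ/4` lets one weight
`exp (-t κ u²)` dominate all error terms. -/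
theorem exists_re_phase_le {Φ : ℂ → ℂ} {r σ L : ℝ} (hr : 0 < r) (hσ : 0 < σ)
    (hΦ : DifferentiableOn ℂ Φ (Metric.ball 0 r)) (h0 : taylorCoeff Φ 0 = 0)
    (h1 : taylorCoeff Φ 1 = 0) (h2 : taylorCoeff Φ 2 = (σ : ℂ) / 2) (hL : 0 < L)
    (hcont : ContinuousOn (fun u : ℝ => Φ (u * Complex.I)) (Set.Icc (-L) L))
    (hneg : ∀ u : ℝ, u ≠ 0 → |u| ≤ L → (Φ (u * Complex.I)).re < 0) :
    ∃ κ : ℝ, 0 < κ ∧ κ ≤ σ / 4 ∧ ∀ u : ℝ, |u| ≤ L → (Φ (u * Complex.I)).re ≤ -(κ * u ^ 2) := by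
  obtain ⟨R, hR, hR0, hΦR, -⟩ := exists_quadratic_remainder hr hΦ h0 h1 h2
  obtain ⟨ρ, -, hρ, -, -, hRb, -⟩ := exists_radius_bound (A := R) hr hσ hR hR hR0
  have hnear : ∀ u : ℝ, |u| ≤ ρ → (Φ (u * Complex.I)).re ≤ -(σ / 4 * u ^ 2) := by
    intro u hu
    have h3 := hRb (u * Complex.I) (by simpa using hu)
    have h4 := (Complex.abs_re_le_norm (R (u * Complex.I))).trans h3
    have h5 : Φ (u * Complex.I) = ((-(σ / 2 * u ^ 2) : ℝ) : ℂ) +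
        ((-(u ^ 2) : ℝ) : ℂ) * R (u * Complex.I) := by
      rw [hΦR, mul_pow, Complex.I_sq]; push_cast; ring
    rw [h5, Complex.add_re, Complex.ofReal_re, Complex.re_ofReal_mul]
    have h6 := (abs_le.mp h4).1
    nlinarith [mul_nonneg (sq_nonneg u) (by linarith : 0 ≤ (R (u * Complex.I)).re + σ / 4)]
  set K : Set ℝ := Set.Icc (-L) L ∩ {u | ρ ≤ |u|} with hK
  have hKc : IsCompact K :=
    isCompact_Icc.inter_right (isClosed_le continuous_const continuous_abs)
  have hm : ∃ m : ℝ, 0 < m ∧ ∀ u ∈ K, (Φ (u * Complex.I)).re ≤ -m := by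
    rcases K.eq_empty_or_nonempty with hem | hne
    · exact ⟨1, one_pos, by simp [hem]⟩
    · obtain ⟨w, hw, hmax⟩ := hKc.exists_isMaxOn hne
        ((Complex.continuous_re.comp_continuousOn hcont).mono Set.inter_subset_left)
      refine ⟨-(Φ (w * Complex.I)).re, ?_, fun u hu => ?_⟩
      · have hw0 : w ≠ 0 := by
          rintro rfl
          have := hw.2
          simp only [Set.mem_ofPred_eq, abs_zero] at this
          linarith
        linarith [hneg w hw0 (abs_le.mpr hw.1)]
      · rw [neg_neg]; exact hmax hu
  obtain ⟨m, hm0, hm⟩ := hm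
  refine ⟨min (σ / 4) (m / L ^ 2), lt_min (by positivity) (by positivity), min_le_left _ _,
    fun u hu => ?_⟩
  rcases le_total |u| ρ with h | h
  · refine (hnear u h).trans (neg_le_neg ?_)
    exact mul_le_mul_of_nonneg_right (min_le_left _ _) (sq_nonneg u)
  · refine (hm u ⟨abs_le.mp hu, h⟩).trans (neg_le_neg ?_)
    calc min (σ / 4) (m / L ^ 2) * u ^ 2 ≤ m / L ^ 2 * L ^ 2 := by
          exact mul_le_mul (min_le_right _ _) (sq_le_sq' (abs_le.mp hu).1 (abs_le.mp hu).2)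
            (sq_nonneg u) (by positivity)
      _ = m := by field_simp

/-- Laplace's method with a complex phase: the full asymptotic expansion. -/
theorem laplace_expansion {G Ψ Φ : ℂ → ℂ} {r σ L : ℝ} (hr : 0 < r) (hσ : 0 < σ)
    (hG : DifferentiableOn ℂ G (Metric.ball 0 r)) (hΨ : DifferentiableOn ℂ Ψ (Metric.ball 0 r))
    (hΦ : DifferentiableOn ℂ Φ (Metric.ball 0 r)) (h0 : taylorCoeff Φ 0 = 0)
    (h1 : taylorCoeff Φ 1 = 0) (h2 : taylorCoeff Φ 2 = (σ : ℂ) / 2) (hL : 0 < L)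
    (hGc : ContinuousOn (fun u : ℝ => G (u * Complex.I)) (Set.Icc (-L) L))
    (hΨc : ContinuousOn (fun u : ℝ => Ψ (u * Complex.I)) (Set.Icc (-L) L))
    (hΦc : ContinuousOn (fun u : ℝ => Φ (u * Complex.I)) (Set.Icc (-L) L))
    {κ : ℝ} (hκ : 0 < κ) (hκσ : κ ≤ σ / 4)
    (hre : ∀ u : ℝ, |u| ≤ L → (Φ (u * Complex.I)).re ≤ -(κ * u ^ 2)) (v : ℕ) :
    ∃ C : ℝ, ∀ t : ℝ, 0 < t →
      ‖(∫ u in (-L)..L, G (u * Complex.I) * Ψ (u * Complex.I) *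
          Complex.exp (t * Φ (u * Complex.I))) -
        (√(2 * Real.pi / (t * σ)) : ℂ) * ∑ k ∈ Finset.range v,
          (∑ p ∈ Finset.HasAntidiagonal.antidiagonal (2 * k),
            ∑ r ∈ Finset.HasAntidiagonal.antidiagonal p.2, taylorCoeff G p.1 * taylorCoeff Ψ r.1 *
              gaussianFaaSum σ (fun i => taylorCoeff Φ (i + 3)) k r.2) / (t : ℂ) ^ k‖ ≤
        C * (1 / (√t * t ^ v)) := by
  -- Shrinking the radius to at most `L` keeps the zone `|u| ≤ ρ` inside the interval of
  -- integration.
  set r' := min r L with hr'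
  have hr'0 : 0 < r' := lt_min hr hL
  have hsub : Metric.ball (0 : ℂ) r' ⊆ Metric.ball 0 r := Metric.ball_subset_ball (min_le_left _ _)
  obtain ⟨R, hR, hR0, hΦR, hRc⟩ := exists_quadratic_remainder hr hΦ h0 h1 h2
  obtain ⟨ρ, C₁, hρ, hρr, hC₁, -, hap⟩ := norm_exp_sub_gaussianApprox_le hr'0 hσ
    ((hG.mono hsub).mul (hΨ.mono hsub)) (hR.mono hsub) hR0 (2 * v)
  have hρL : ρ < L := hρr.trans_le (min_le_right _ _)
  obtain ⟨M, hM⟩ := isCompact_Icc.exists_bound_of_continuousOn (hGc.mul hΨc)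
  have hM0 : 0 ≤ M := (norm_nonneg _).trans (hM 0 ⟨by linarith, hL.le⟩)
  have han : ∀ f : ℂ → ℂ, DifferentiableOn ℂ f (Metric.ball 0 r) → AnalyticAt ℂ f 0 :=
    fun f hf => hf.analyticAt (Metric.ball_mem_nhds 0 hr)
  have hGa := han G hG
  have hΨa := han Ψ hΨ
  have hRa := han R hR
  set C₀ := M / ρ ^ (2 * v) + C₁ with hC₀
  refine ⟨C₀ * (√(2 * Real.pi / (2 * κ)) * ((2 * v - 1).doubleFactorial : ℝ) / (2 * κ) ^ v),
    fun t ht => ?_⟩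
  set F : ℝ → ℂ := fun u => G (u * Complex.I) * Ψ (u * Complex.I) *
    Complex.exp (t * Φ (u * Complex.I)) with hF
  have hFc : ContinuousOn F (Set.Icc (-L) L) :=
    (hGc.mul hΨc).mul (continuousOn_const.mul hΦc).cexp
  have hFi : IntegrableOn F (Set.Ioc (-L) L) :=
    (hFc.integrableOn_Icc).mono_set Set.Ioc_subset_Icc_self
  simp only [← hRc]
  rw [← integral_gaussianApprox hGa hΨa hRa hR0 hσ ht v,
    intervalIntegral.integral_of_le (by linarith), ← integral_indicator measurableSet_Ioc,
    ← integral_sub (hFi.integrable_indicator measurableSet_Ioc)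
      (integrable_gaussianApprox hGa hΨa hRa hR0 hσ ht _), mul_assoc,
    ← integral_even_pow_mul_exp_neg_scale hκ ht, ← integral_const_mul]
  refine norm_integral_le_of_norm_le
    ((integrable_pow_mul_exp_neg_mul_sq (by positivity) _).const_mul _) (ae_of_all _ fun u => ?_)
  have habs : |u| ^ (2 * v) = u ^ (2 * v) := (even_two_mul v).pow_abs u
  have hexp : Real.exp (-(t * (σ / 4) * u ^ 2)) ≤ Real.exp (-(t * κ * u ^ 2)) := by
    gcongr
  obtain ⟨hap1, hap2⟩ := hap t u ht.le
  rw [habs] at hap1 hap2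
  have hu2 : 0 ≤ u ^ (2 * v) := by rw [← habs]; positivity
  have hb1 : C₁ * u ^ (2 * v) * Real.exp (-(t * (σ / 4) * u ^ 2)) ≤
      C₁ * (u ^ (2 * v) * Real.exp (-(t * κ * u ^ 2))) := by
    rw [mul_assoc]; gcongr
  have hb0 : 0 ≤ u ^ (2 * v) * Real.exp (-(t * κ * u ^ 2)) := by positivity
  have hMρ : 0 ≤ M / ρ ^ (2 * v) := by positivity
  rcases le_or_gt |u| ρ with hu | hu
  · have hmem : u ∈ Set.Ioc (-L) L :=
      ⟨by linarith [(abs_le.mp hu).1], by linarith [(abs_le.mp hu).2]⟩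
    rw [Set.indicator_of_mem hmem]
    have h3 := hap1 hu
    rw [← hΦR] at h3
    exact h3.trans (hb1.trans (mul_le_mul_of_nonneg_right (by linarith) hb0))
  · have h3 := (hap2 hu.le).trans hb1
    by_cases hmem : u ∈ Set.Ioc (-L) L
    · rw [Set.indicator_of_mem hmem]
      -- For `|u| > ρ` the factor `(u/ρ)^(2v) ≥ 1` can be inserted for free, so this zone obeys the
      -- same bound as the central one.
      have hFb : ‖F u‖ ≤ M / ρ ^ (2 * v) * (u ^ (2 * v) * Real.exp (-(t * κ * u ^ 2))) := by
        have h4 : ‖F u‖ ≤ M * Real.exp (-(t * κ * u ^ 2)) := by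
          simp only [hF]
          rw [norm_mul, Complex.norm_exp, Complex.re_ofReal_mul]
          refine mul_le_mul (hM u (Set.Ioc_subset_Icc_self hmem)) (Real.exp_le_exp.mpr ?_)
            (Real.exp_pos _).le hM0
          have := hre u (abs_le.mpr (Set.Ioc_subset_Icc_self hmem))
          nlinarith
        have h5 : (1 : ℝ) ≤ u ^ (2 * v) / ρ ^ (2 * v) := by
          rw [one_le_div (by positivity), ← habs]
          gcongr
        calc ‖F u‖ ≤ M * Real.exp (-(t * κ * u ^ 2)) * 1 := by rw [mul_one]; exact h4
          _ ≤ M * Real.exp (-(t * κ * u ^ 2)) * (u ^ (2 * v) / ρ ^ (2 * v)) := by gcongr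
          _ = _ := by ring
      calc _ ≤ ‖F u‖ + ‖gaussianApprox (fun s => G s * Ψ s) R σ (2 * v) t u‖ := norm_sub_le _ _
        _ ≤ _ := by rw [hC₀, add_mul]; exact add_le_add hFb h3
    · rw [Set.indicator_of_notMem hmem, zero_sub, norm_neg]
      exact h3.trans (mul_le_mul_of_nonneg_right (by linarith) hb0)

/-! ### The strip and cumulant generating functions. -/

/-- The real points of the strip. -/
def realStrip (c d : EReal) : Set ℝ := {θ : ℝ | c < (θ : EReal) ∧ (θ : EReal) < d}

theorem isOpen_realStrip (c d : EReal) : IsOpen (realStrip c d) :=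
  (isOpen_Ioo (a := c) (b := d)).preimage continuous_coe_real_ereal

theorem isOpen_strip (c d : EReal) : IsOpen (strip c d) :=
  (isOpen_realStrip c d).preimage Complex.continuous_re

theorem ordConnected_realStrip (c d : EReal) : (realStrip c d).OrdConnected := by
  refine ⟨fun a ha b hb y hy => ⟨?_, ?_⟩⟩
  · exact ha.1.trans_le (EReal.coe_le_coe_iff.mpr hy.1)
  · exact lt_of_le_of_lt (EReal.coe_le_coe_iff.mpr hy.2) hb.2

theorem mem_strip_iff {c d : EReal} {z : ℂ} : z ∈ strip c d ↔ z.re ∈ realStrip c d := Iff.rfl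

theorem ofReal_mem_strip {c d : EReal} {θ : ℝ} (h : θ ∈ realStrip c d) : (θ : ℂ) ∈ strip c d := by
  simpa [mem_strip_iff] using h

section Cumulant

variable {Ω : Type*} [MeasurableSpace Ω] {μ : Measure Ω} {Y : Ω → ℝ}

theorem realStrip_subset_interior {c d : EReal}
    (h : ∀ θ : ℝ, c < (θ : EReal) → (θ : EReal) < d → Integrable (fun ω => Real.exp (θ * Y ω)) μ) :
    realStrip c d ⊆ interior (integrableExpSet Y μ) :=
  interior_maximal (fun θ hθ => h θ hθ.1 hθ.2) (isOpen_realStrip c d)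

/-- The second derivative is the variance of `Y` under the tilted law; if it vanished, `Y` would be
almost surely equal to its tilted mean. -/
theorem iteratedDeriv_two_cgf_pos [IsProbabilityMeasure μ] {θ : ℝ}
    (hθ : θ ∈ interior (integrableExpSet Y μ)) (hne : ∀ a : ℝ, ¬ ∀ᵐ ω ∂μ, Y ω = a) :
    0 < iteratedDeriv 2 (cgf Y μ) θ := by
  rw [iteratedDeriv_two_cgf_eq_integral hθ]
  set m := deriv (cgf Y μ) θ
  have hpos : 0 < mgf Y μ θ := mgf_pos (interior_subset (s := integrableExpSet Y μ) hθ)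
  refine div_pos ?_ hpos
  have h0 : 0 ≤ fun ω => (Y ω - m) ^ 2 * Real.exp (θ * Y ω) := fun ω => by
    simp only [Pi.zero_apply]; positivity
  have hint : Integrable (fun ω => (Y ω - m) ^ 2 * Real.exp (θ * Y ω)) μ := by
    have h1 := integrable_pow_mul_exp_of_mem_interior_integrableExpSet hθ 2
    have h2 := (integrable_pow_mul_exp_of_mem_interior_integrableExpSet hθ 1).const_mul (2 * m)
    have h3 := (integrable_pow_mul_exp_of_mem_interior_integrableExpSet hθ 0).const_mul (m ^ 2)
    refine ((h1.sub h2).add h3).congr (ae_of_all _ fun ω => ?_)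
    simp only [Pi.add_apply, Pi.sub_apply]
    ring
  refine lt_of_le_of_ne (integral_nonneg h0) fun h => hne m ?_
  filter_upwards [(integral_eq_zero_iff_of_nonneg h0 hint).mp h.symm] with ω hω
  simpa [sub_eq_zero, (Real.exp_pos _).ne'] using hω

/-- The tangent line inequality for the cumulant generating function. -/
theorem cgf_add_deriv_mul_le [IsProbabilityMeasure μ] {h θ : ℝ}
    (hh : h ∈ interior (integrableExpSet Y μ)) (hθ : Integrable (fun ω => Real.exp (θ * Y ω)) μ) :
    cgf Y μ h + deriv (cgf Y μ) h * (θ - h) ≤ cgf Y μ θ := by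
  set x := deriv (cgf Y μ) h with hx
  have hpos : 0 < mgf Y μ h := mgf_pos (interior_subset (s := integrableExpSet Y μ) hh)
  have hmean : ∫ ω, Y ω * Real.exp (h * Y ω) ∂μ = x * mgf Y μ h := by
    rw [hx, deriv_cgf hh, div_mul_cancel₀ _ hpos.ne']
  have hi1 : Integrable (fun ω => Y ω * Real.exp (h * Y ω)) μ := by
    simpa using integrable_pow_mul_exp_of_mem_interior_integrableExpSet hh 1
  have hi0 : Integrable (fun ω => Real.exp (h * Y ω)) μ :=
    interior_subset (s := integrableExpSet Y μ) hh
  set e := Real.exp ((θ - h) * x) with he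
  -- Jensen under the tilted law: use `1 + s ≤ exp s` with `s = (θ - h)(Y - x)`. The linear term
  -- integrates to zero since `x` is the tilted mean.
  have hle : mgf Y μ h * e ≤ mgf Y μ θ := by
    have h1 : ∫ ω, ((e * (1 - (θ - h) * x)) * Real.exp (h * Y ω) +
        (e * (θ - h)) * (Y ω * Real.exp (h * Y ω))) ∂μ = mgf Y μ h * e := by
      rw [integral_add (hi0.const_mul _) (hi1.const_mul _), integral_const_mul, integral_const_mul,
        hmean, mgf]
      ring
    rw [← h1]
    refine integral_mono ((hi0.const_mul _).add (hi1.const_mul _)) hθ fun ω => ?_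
    have h2 := Real.add_one_le_exp ((θ - h) * (Y ω - x))
    have h3 : Real.exp (θ * Y ω) =
        e * Real.exp (h * Y ω) * Real.exp ((θ - h) * (Y ω - x)) := by
      rw [he, ← Real.exp_add, ← Real.exp_add]; congr 1; ring
    simp only
    rw [h3]
    have h4 : 0 ≤ e * Real.exp (h * Y ω) := by positivity
    nlinarith
  have h5 := Real.log_le_log (by positivity) hle
  rw [Real.log_mul hpos.ne' (Real.exp_pos _).ne', Real.log_exp] at h5
  simp only [cgf]
  linarith

end Cumulant

/-! ### The exponent: saddle point, rate function and strict decay off the real axis. -/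

namespace IsExponentOn

variable {φ : Measure ℝ} {η : ℂ → ℂ} {c d : EReal}

theorem subset_interior (H : IsExponentOn φ η c d) :
    realStrip c d ⊆ interior (integrableExpSet id φ) :=
  realStrip_subset_interior H.integrable

theorem not_ae_const (H : IsExponentOn φ η c d) (a : ℝ) : ¬ ∀ᵐ y ∂φ, id y = a := by
  intro h
  have := H.isProbabilityMeasure
  refine H.nonconstant a ?_
  have h1 : φ.map id = φ.map fun _ => a := Measure.map_congr h
  rwa [Measure.map_id, Measure.map_const, measure_univ, one_smul] at h1

/-- Realness of `η` removes the `2πi ℤ` ambiguity of the logarithm, so real convexity arguments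
apply to `η`. -/
theorem apply_ofReal (H : IsExponentOn φ η c d) {θ : ℝ} (hθ : θ ∈ realStrip c d) :
    η θ = (cgf id φ θ : ℂ) := by
  have := H.isProbabilityMeasure
  have h1 := H.exp_eq θ (ofReal_mem_strip hθ)
  have h2 : ∫ y : ℝ, Complex.exp (θ * (y : ℂ)) ∂φ = (mgf id φ θ : ℂ) := complexMGF_ofReal θ
  have h3 : η θ = ((η θ).re : ℂ) := by
    apply Complex.ext <;> simp [H.real_on_real θ hθ.1 hθ.2]
  rw [h2, h3, ← Complex.ofReal_exp, Complex.ofReal_inj] at h1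
  rw [h3, cgf, ← h1, Real.log_exp]

theorem differentiableAt (H : IsExponentOn φ η c d) {z : ℂ} (hz : z ∈ strip c d) :
    DifferentiableAt ℂ η z :=
  H.holomorphic.differentiableAt ((isOpen_strip c d).mem_nhds hz)

theorem deriv_ofReal (H : IsExponentOn φ η c d) {θ : ℝ} (hθ : θ ∈ realStrip c d) :
    deriv η θ = ((deriv (cgf id φ) θ : ℝ) : ℂ) := by
  have h1 := (H.differentiableAt (ofReal_mem_strip hθ)).hasDerivAt.comp_ofReal
  have h2 := ((analyticAt_cgf (H.subset_interior hθ)).differentiableAt.hasDerivAt).ofReal_comp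
  refine (h1.congr_of_eventuallyEq ?_).unique h2
  filter_upwards [(isOpen_realStrip c d).mem_nhds hθ] with y hy
  exact (H.apply_ofReal hy).symm

theorem iteratedDeriv_two_ofReal (H : IsExponentOn φ η c d) {θ : ℝ} (hθ : θ ∈ realStrip c d) :
    iteratedDeriv 2 η θ = ((iteratedDeriv 2 (cgf id φ) θ : ℝ) : ℂ) := by
  rw [iteratedDeriv_succ, iteratedDeriv_one, iteratedDeriv_succ, iteratedDeriv_one]
  have h0 : DifferentiableAt ℂ (deriv η) θ :=
    (H.holomorphic.analyticAt ((isOpen_strip c d).mem_nhds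
      (ofReal_mem_strip hθ))).deriv.differentiableAt
  have h1 := h0.hasDerivAt.comp_ofReal
  have h2 := ((analyticAt_cgf (H.subset_interior hθ)).deriv.differentiableAt.hasDerivAt).ofReal_comp
  refine (h1.congr_of_eventuallyEq ?_).unique h2
  filter_upwards [(isOpen_realStrip c d).mem_nhds hθ] with y hy
  exact (H.deriv_ofReal hy).symm

theorem iteratedDeriv_two_pos (H : IsExponentOn φ η c d) {θ : ℝ} (hθ : θ ∈ realStrip c d) :
    0 < iteratedDeriv 2 (cgf id φ) θ := by
  have := H.isProbabilityMeasure
  exact iteratedDeriv_two_cgf_pos (H.subset_interior hθ) H.not_ae_const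

theorem continuousOn_deriv_cgf (H : IsExponentOn φ η c d) :
    ContinuousOn (deriv (cgf id φ)) (realStrip c d) := fun _ hθ =>
  (analyticAt_cgf (H.subset_interior hθ)).deriv.continuousAt.continuousWithinAt

theorem strictMonoOn_deriv_cgf (H : IsExponentOn φ η c d) :
    StrictMonoOn (deriv (cgf id φ)) (realStrip c d) := by
  refine strictMonoOn_of_deriv_pos (ordConnected_realStrip c d).convex H.continuousOn_deriv_cgf
    fun θ hθ => ?_
  have := H.iteratedDeriv_two_pos (interior_subset hθ)
  rwa [iteratedDeriv_succ, iteratedDeriv_one] at this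

theorem existsUnique_deriv_eq (H : IsExponentOn φ η c d) (hc : c < 0) (hd : 0 < d) {x : ℝ}
    (hx0 : (deriv η 0).re < x) (hxd : (x : EReal) < derivAtRightEnd η d) :
    ∃! h : ℝ, (c < (h : EReal) ∧ (h : EReal) < d) ∧ deriv η (h : ℂ) = (x : ℂ) := by
  have h0 : (0 : ℝ) ∈ realStrip c d := ⟨by simpa using hc, by simpa using hd⟩
  have hev : ∀ᶠ θ : ℝ in comap Real.toEReal (𝓝[<] d), (0 : EReal) < θ ∧ (θ : EReal) < d :=
    Filter.Eventually.comap (Ioo_mem_nhdsLT hd) _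
  -- The upper limit exceeds `x`, so some `θ` in `(0, d)` has `η'(θ) > x`; the intermediate value
  -- theorem then applies on `[0, θ]`.
  obtain ⟨θ, hθx, hθ0, hθd⟩ := ((frequently_lt_of_lt_limsup (by isBoundedDefault) hxd).and_eventually
    hev).exists
  have hθ : θ ∈ realStrip c d := ⟨hc.trans hθ0, hθd⟩
  rw [H.deriv_ofReal hθ, Complex.ofReal_re, EReal.coe_lt_coe_iff] at hθx
  have h0' := H.deriv_ofReal h0
  rw [Complex.ofReal_zero] at h0'
  rw [h0', Complex.ofReal_re] at hx0
  have hsub : Set.Icc 0 θ ⊆ realStrip c d := (ordConnected_realStrip c d).out h0 hθ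
  have hθ0' : 0 ≤ θ := by exact_mod_cast hθ0.le
  obtain ⟨h, hh, hhx⟩ := intermediate_value_Icc hθ0' (H.continuousOn_deriv_cgf.mono hsub)
    ⟨hx0.le, hθx.le⟩
  refine ⟨h, ⟨hsub hh, by rw [H.deriv_ofReal (hsub hh), hhx]⟩, fun h' hh' => ?_⟩
  refine H.strictMonoOn_deriv_cgf.injOn hh'.1 (hsub hh) ?_
  have := hh'.2
  rw [H.deriv_ofReal hh'.1, Complex.ofReal_inj] at this
  rw [this, hhx]

/-- The tangent inequality at `h` holds at every `θ` with a finite exponential moment, even outside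
`(c, d)`, so the supremum is attained at `h`. -/
theorem rateFunction_eq (H : IsExponentOn φ η c d) {h x : ℝ} (hh : h ∈ realStrip c d)
    (hx : deriv η h = (x : ℂ)) : rateFunction φ x = h * x - cgf id φ h := by
  have := H.isProbabilityMeasure
  rw [H.deriv_ofReal hh, Complex.ofReal_inj] at hx
  have : Nonempty {θ : ℝ // Integrable (fun y : ℝ => Real.exp (θ * y)) φ} :=
    ⟨⟨h, H.integrable h hh.1 hh.2⟩⟩
  refine IsLUB.ciSup_eq ?_
  refine IsGreatest.isLUB ⟨⟨⟨h, H.integrable h hh.1 hh.2⟩, rfl⟩, ?_⟩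
  rintro _ ⟨⟨θ, hθ⟩, rfl⟩
  have h1 := cgf_add_deriv_mul_le (Y := id) (H.subset_interior hh) hθ
  rw [hx] at h1
  have h2 : cgf id φ θ = Real.log (∫ y : ℝ, Real.exp (θ * y) ∂φ) := rfl
  simp only [← h2]
  linarith

/-- A law with minimal lattice `ℤ` has a characteristic function of modulus less than one
away from the origin on `[-π, π]`, also after exponential tilting. -/
theorem re_lt_of_minimalLattice (H : IsExponentOn φ η c d) (hφ : HasMinimalLatticeInt φ)
    {h u : ℝ} (hh : h ∈ realStrip c d) (hu : u ≠ 0) (huπ : |u| ≤ Real.pi) :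
    (η (h + u * Complex.I)).re < cgf id φ h := by
  have := H.isProbabilityMeasure
  have hint := H.integrable h hh.1 hh.2
  have hpos : 0 < mgf id φ h := mgf_pos hint
  set z : ℂ := h + u * Complex.I with hz
  have hzre : z.re = h := by simp [hz]
  have hexp := H.exp_eq z (by rw [mem_strip_iff, hzre]; exact hh)
  set I := ∫ y : ℝ, Complex.exp (z * (y : ℂ)) ∂φ with hI
  have hnorm : Real.exp (η z).re = ‖I‖ := by rw [← hexp, Complex.norm_exp]
  rw [cgf, Real.lt_log_iff_exp_lt hpos, hnorm]
  by_contra! hle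
  set α := Complex.arg I with hα
  -- Equality case of the triangle inequality: rotating `I` onto the positive axis forces `∫ e^{hy}
  -- (1 - cos (u y - α)) φ(dy) = 0`, hence `u y - α ∈ 2π ℤ` almost surely.
  have hrot : ((‖I‖ : ℝ) : ℂ) = Complex.exp (-(α * Complex.I)) * I := by
    conv_rhs => rw [← Complex.norm_mul_exp_arg_mul_I I]
    rw [mul_left_comm, ← Complex.exp_add, ← hα, neg_add_cancel, Complex.exp_zero, mul_one]
  have hcint : Integrable (fun y : ℝ => Complex.exp (z * (y : ℂ))) φ := by
    refine (integrable_norm_iff (by fun_prop)).mp (hint.congr (ae_of_all _ fun y => ?_))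
    simp [Complex.norm_exp, hz]
  have hcos : ∀ y : ℝ, (Complex.exp (-(α * Complex.I)) * Complex.exp (z * (y : ℂ))).re =
      Real.exp (h * y) * Real.cos (u * y - α) := by
    intro y
    rw [← Complex.exp_add, Complex.exp_re]
    congr 2
    · simp [hz]
    · simp [hz]; ring
  have hIre : ‖I‖ = ∫ y : ℝ, Real.exp (h * y) * Real.cos (u * y - α) ∂φ := by
    rw [← Complex.ofReal_re ‖I‖, hrot, hI, ← integral_const_mul]
    simp only [← hcos]
    exact (integral_re (hcint.const_mul _)).symm
  have hcosint : Integrable (fun y : ℝ => Real.exp (h * y) * Real.cos (u * y - α)) φ := by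
    simp only [← hcos]
    exact (hcint.const_mul _).re
  have h0 : 0 ≤ fun y : ℝ => Real.exp (h * y) - Real.exp (h * y) * Real.cos (u * y - α) := by
    intro y
    simp only [Pi.zero_apply]
    nlinarith [Real.exp_pos (h * y), Real.cos_le_one (u * y - α)]
  have hzero : ∫ y : ℝ, (Real.exp (h * y) - Real.exp (h * y) * Real.cos (u * y - α)) ∂φ = 0 := by
    refine le_antisymm ?_ (integral_nonneg h0)
    rw [integral_sub hint hcosint, ← hIre]
    have : mgf id φ h = ∫ y : ℝ, Real.exp (h * y) ∂φ := rfl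
    linarith
  have hae := (integral_eq_zero_iff_of_nonneg h0 (hint.sub hcosint)).mp hzero
  have hu' : 0 < |u| := abs_pos.mpr hu
  -- The law would be carried by `α/u + (2π/|u|) ℤ`, whose step is at least `2` because `|u| ≤ π`.
  refine hφ.2 (α / u) (2 * Real.pi / |u|) ?_ ?_
  · rw [lt_div_iff₀ hu']; linarith [Real.pi_pos]
  · filter_upwards [hae] with y hy
    have hc1 : Real.cos (u * y - α) = 1 := by
      simp only [Pi.zero_apply] at hy
      have h2 : Real.exp (h * y) * (1 - Real.cos (u * y - α)) = 0 := by linarith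
      rcases mul_eq_zero.mp h2 with h3 | h3
      · exact absurd h3 (Real.exp_pos _).ne'
      · linarith
    obtain ⟨k, hk⟩ := (Real.cos_eq_one_iff _).mp hc1
    rcases lt_or_gt_of_ne hu with hneg | hpos
    · refine ⟨-k, ?_⟩
      rw [abs_of_neg hneg]
      push_cast
      field_simp
      linarith
    · refine ⟨k, ?_⟩
      rw [abs_of_pos hpos]
      field_simp
      linarith

end IsExponentOn

/-! ### The series `G`: Taylor expansion and Fourier coefficients. -/

/-- The Dirichlet-type series `∑ w q exp (-q s)`. -/
def lagSeries (w : ℕ → ℂ) (s : ℂ) : ℂ := ∑' q : ℕ, w q * Complex.exp (-(q * s))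

section LagSeries

variable {w : ℕ → ℂ} {a δ : ℝ}

theorem summable_exp_neg_mul_nat {δ : ℝ} (hδ : 0 < δ) :
    Summable fun q : ℕ => Real.exp (-(δ * q)) := by
  have h : ∀ q : ℕ, Real.exp (-(δ * q)) = Real.exp (-δ) ^ q := fun q => by
    rw [← Real.exp_nat_mul]; congr 1; ring
  simp only [h]
  exact summable_geometric_of_lt_one (Real.exp_pos _).le 
    ((Real.exp_lt_exp.mpr (neg_lt_zero.mpr hδ)).trans_eq Real.exp_zero)

theorem summable_norm_of_exp_bound (hδ : 0 < δ) (hw : ∀ q, ‖w q‖ ≤ a * Real.exp (-(δ * q))) :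
    Summable fun q => ‖w q‖ :=
  Summable.of_nonneg_of_le (fun _ => norm_nonneg _) hw ((summable_exp_neg_mul_nat hδ).mul_left a)

theorem hasSum_exp_series (z : ℂ) :
    HasSum (fun m : ℕ => z ^ m / (m.factorial : ℂ)) (Complex.exp z) := by
  rw [Complex.exp_eq_exp_ℂ]; exact NormedSpace.expSeries_div_hasSum_exp z

/-- Summing absolute values over the exponential series first gives `∑ ‖w q‖ e^{q‖s‖}`, dominated by
a geometric series of ratio `e^{-(δ-‖s‖)}`. -/
theorem summable_lag_prod (hw : ∀ q, ‖w q‖ ≤ a * Real.exp (-(δ * q)))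
    {s : ℂ} (hs : ‖s‖ < δ) :
    Summable fun p : ℕ × ℕ => w p.1 * ((-(p.1 * s)) ^ p.2 / (p.2.factorial : ℂ)) := by
  refine Summable.of_norm ?_
  have hfib : ∀ q : ℕ, HasSum (fun m : ℕ => ‖w q * ((-(q * s)) ^ m / (m.factorial : ℂ))‖)
      (‖w q‖ * Real.exp (q * ‖s‖)) := by
    intro q
    have h1 : HasSum (fun m : ℕ => (q * ‖s‖) ^ m / (m.factorial : ℝ)) (Real.exp (q * ‖s‖)) := by
      rw [Real.exp_eq_exp_ℝ]; exact NormedSpace.expSeries_div_hasSum_exp _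
    convert! h1.mul_left ‖w q‖ using 2 with m
    rw [norm_mul, norm_div, norm_pow, norm_neg, norm_mul, Complex.norm_natCast,
      Complex.norm_natCast]
  rw [summable_prod_of_nonneg fun _ => norm_nonneg _]
  refine ⟨fun q => (hfib q).summable, ?_⟩
  simp only [(hfib _).tsum_eq]
  refine Summable.of_nonneg_of_le (fun q => by positivity) (fun q => ?_)
    ((summable_exp_neg_mul_nat (δ := δ - ‖s‖) (by linarith)).mul_left a)
  calc ‖w q‖ * Real.exp (q * ‖s‖) ≤ a * Real.exp (-(δ * q)) * Real.exp (q * ‖s‖) := by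
        gcongr; exact hw q
    _ = a * Real.exp (-((δ - ‖s‖) * q)) := by
        rw [mul_assoc, ← Real.exp_add]; congr 2; ring

theorem summable_lag_moment (hδ : 0 < δ) (hw : ∀ q, ‖w q‖ ≤ a * Real.exp (-(δ * q))) (m : ℕ) :
    Summable fun q : ℕ => w q * ((-(q : ℂ)) ^ m / (m.factorial : ℂ)) := by
  have hs : ‖((δ / 2 : ℝ) : ℂ)‖ < δ := by
    rw [Complex.norm_real, Real.norm_of_nonneg (by positivity)]; linarith
  have h := (summable_lag_prod hw hs).comp_injective
    (i := fun q : ℕ => (q, m)) fun q q' h => congrArg Prod.fst h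
  have h0 : (((δ / 2 : ℝ) : ℂ)) ^ m ≠ 0 := pow_ne_zero _ (by exact_mod_cast (half_pos hδ).ne')
  rw [← summable_mul_right_iff h0]
  convert! h using 2 with q
  simp only [Function.comp_apply]
  rw [← neg_mul, mul_pow]
  ring

/-- Expand each `e^{-qs}` and exchange the two sums. For `w q = g(q) e^{-qh}` the resulting
coefficients are the numbers `gSeries g h m`. -/
theorem hasSum_lagSeries (hw : ∀ q, ‖w q‖ ≤ a * Real.exp (-(δ * q))) {s : ℂ} (hs : ‖s‖ < δ) :
    HasSum (fun m : ℕ => (∑' q : ℕ, w q * ((-(q : ℂ)) ^ m / (m.factorial : ℂ))) * s ^ m)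
      (lagSeries w s) := by
  have hδ : 0 < δ := (norm_nonneg s).trans_lt hs
  have hT := (summable_lag_prod hw hs).hasSum
  have h1 := hT.prod_fiberwise (g := fun q : ℕ => w q * Complex.exp (-(q * s)))
    fun q => (hasSum_exp_series (-(q * s))).mul_left (w q)
  have h2 := ((Equiv.prodComm ℕ ℕ).hasSum_iff.mpr hT).prod_fiberwise
    (g := fun m : ℕ => (∑' q : ℕ, w q * ((-(q : ℂ)) ^ m / (m.factorial : ℂ))) * s ^ m) ?_
  · rw [lagSeries, h1.tsum_eq]; exact h2
  · intro m
    convert! (summable_lag_moment hδ hw m).hasSum.mul_right (s ^ m) using 2 with q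
    simp only [Function.comp_apply, Equiv.prodComm_apply, Prod.fst_swap, Prod.snd_swap]
    rw [← neg_mul, mul_pow]
    ring

theorem norm_lag_term (q : ℕ) (u : ℝ) :
    ‖w q * Complex.exp (-(q * (u * Complex.I)))‖ = ‖w q‖ := by
  rw [norm_mul, Complex.norm_exp]
  simp

theorem continuous_lagSeries_mul_I (hsum : Summable fun q => ‖w q‖) :
    Continuous fun u : ℝ => lagSeries w (u * Complex.I) :=
  continuous_tsum (fun q => by fun_prop) hsum fun q u => (norm_lag_term q u).le

theorem norm_lagSeries_mul_I_le (hsum : Summable fun q => ‖w q‖) (u : ℝ) :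
    ‖lagSeries w (u * Complex.I)‖ ≤ ∑' q, ‖w q‖ :=
  tsum_of_norm_bounded hsum.hasSum fun q => (norm_lag_term q u).le

theorem integral_exp_int_mul_I (k : ℤ) :
    ∫ u in (-Real.pi)..Real.pi, Complex.exp (k * Complex.I * u) =
      if k = 0 then (2 * Real.pi : ℂ) else 0 := by
  split_ifs with hk
  · subst hk; simp; ring
  · have hc : (k : ℂ) * Complex.I ≠ 0 := mul_ne_zero (by exact_mod_cast hk) Complex.I_ne_zero
    rw [integral_exp_mul_complex hc, div_eq_zero_iff]
    left
    rw [sub_eq_zero, Complex.exp_eq_exp_iff_exists_int]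
    exact ⟨k, by push_cast; ring⟩

/-- The Fourier coefficients of the boundary values of `lagSeries`. -/
theorem integral_lagSeries_mul_exp (hsum : Summable fun q => ‖w q‖) (k : ℤ) :
    ∫ u in (-Real.pi)..Real.pi, lagSeries w (u * Complex.I) * Complex.exp (k * Complex.I * u) =
      if 0 ≤ k then 2 * Real.pi * w k.toNat else 0 := by
  have h := intervalIntegral.hasSum_integral_of_dominated_convergence (μ := volume)
    (a := -Real.pi) (b := Real.pi)
    (F := fun (q : ℕ) (u : ℝ) => w q * Complex.exp (-(q * (u * Complex.I))) *
      Complex.exp (k * Complex.I * u))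
    (f := fun u : ℝ => lagSeries w (u * Complex.I) * Complex.exp (k * Complex.I * u))
    (fun q _ => ‖w q‖) (fun q => (by fun_prop : Continuous _).aestronglyMeasurable)
    (fun q => ae_of_all _ fun u _ => by
      rw [norm_mul, norm_lag_term, Complex.norm_exp]; simp)
    (ae_of_all _ fun u _ => hsum) intervalIntegrable_const
    (ae_of_all _ fun u _ => HasSum.mul_right _
      (Summable.of_norm (by simpa only [norm_lag_term] using hsum)).hasSum)
  have hterm : ∀ q : ℕ, ∫ u in (-Real.pi)..Real.pi, w q * Complex.exp (-(q * (u * Complex.I))) *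
      Complex.exp (k * Complex.I * u) = w q * if k - q = 0 then (2 * Real.pi : ℂ) else 0 := by
    intro q
    rw [← integral_exp_int_mul_I, ← intervalIntegral.integral_const_mul]
    refine intervalIntegral.integral_congr fun u _ => ?_
    rw [mul_assoc, ← Complex.exp_add]
    congr 2
    push_cast
    ring
  simp only [hterm] at h
  rw [← h.tsum_eq]
  split_ifs with hk
  · rw [tsum_eq_single k.toNat]
    · rw [if_pos (by omega)]; ring
    · intro q hq
      rw [if_neg (by omega), mul_zero]
  · have : ∀ q : ℕ, (w q * if k - q = 0 then (2 * Real.pi : ℂ) else 0) = 0 := fun q => by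
      rw [if_neg (by omega), mul_zero]
    simp [this]

end LagSeries

/-! ### Fourier inversion and integrability of the tail functional. -/

section Tail

variable {Ω : Type*} [MeasurableSpace Ω] {P : Measure Ω} {Y : Ω → ℝ}

/-- Fourier inversion for functionals of the overshoot of an integer valued variable. -/
theorem integral_lagSeries_mul_complexMGF [IsProbabilityMeasure P] (hY : AEMeasurable Y P)
    (hYint : ∀ᵐ ω ∂P, ∃ k : ℤ, Y ω = k) {h : ℝ}
    (hexp : Integrable (fun ω => Real.exp (h * Y ω)) P) {g : ℝ → ℝ}
    (hsum : Summable fun q : ℕ => ‖((g q * Real.exp (-(q * h)) : ℝ) : ℂ)‖) (N : ℕ) :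
    ∫ u in (-Real.pi)..Real.pi,
        lagSeries (fun q => ((g q * Real.exp (-(q * h)) : ℝ) : ℂ)) (u * Complex.I) *
          (Complex.exp (-((h + u * Complex.I) * N)) * complexMGF Y P (h + u * Complex.I)) =
      2 * Real.pi *
        ((∫ ω, Set.indicator {ω | (N : ℝ) ≤ Y ω} (fun ω => g (Y ω - N)) ω ∂P : ℝ) : ℂ) := by
  set w : ℕ → ℂ := fun q => ((g q * Real.exp (-(q * h)) : ℝ) : ℂ) with hw
  set f : ℝ → Ω → ℂ := fun u ω => lagSeries w (u * Complex.I) *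
    (Complex.exp (-((h + u * Complex.I) * N)) *
      Complex.exp ((h + u * Complex.I) * (Y ω : ℂ))) with hf
  have hG := continuous_lagSeries_mul_I hsum
  have hfint : Integrable (Function.uncurry f)
      ((volume.restrict (Set.uIoc (-Real.pi) Real.pi)).prod P) := by
    have hB : Integrable (fun _ : ℝ => (∑' q, ‖w q‖) * Real.exp (-(h * N)))
        (volume.restrict (Set.uIoc (-Real.pi) Real.pi)) := by
      rw [← IntegrableOn, ← intervalIntegrable_iff]; exact intervalIntegrable_const
    refine (hB.mul_prod hexp).mono' ?_ (ae_of_all _ fun p => ?_)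
    · have hY2 : AEMeasurable (fun p : ℝ × Ω => Y p.2)
          ((volume.restrict (Set.uIoc (-Real.pi) Real.pi)).prod P) := hY.comp_snd
      have hG2 : Measurable fun p : ℝ × Ω => lagSeries w (p.1 * Complex.I) :=
        hG.measurable.comp measurable_fst
      have hu2 : Measurable fun p : ℝ × Ω => ((h : ℂ) + p.1 * Complex.I) := by fun_prop
      refine (hG2.aemeasurable.mul (AEMeasurable.mul ?_ ?_)).aestronglyMeasurable
      · exact (Complex.measurable_exp.comp (hu2.mul_const _).neg).aemeasurable
      · exact Complex.measurable_exp.comp_aemeasurable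
          (hu2.aemeasurable.mul (Complex.measurable_ofReal.comp_aemeasurable hY2))
    · rw [Function.uncurry, hf]
      simp only
      rw [norm_mul, norm_mul, Complex.norm_exp, Complex.norm_exp, ← mul_assoc]
      have e1 : (-(((h : ℂ) + p.1 * Complex.I) * N)).re = -(h * N) := by simp
      have e2 : (((h : ℂ) + p.1 * Complex.I) * (Y p.2 : ℂ)).re = h * Y p.2 := by simp
      rw [e1, e2]
      gcongr
      exact norm_lagSeries_mul_I_le hsum p.1
  have hswap := intervalIntegral_integral_swap hfint
  have hlhs : ∀ u : ℝ, lagSeries w (u * Complex.I) *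
      (Complex.exp (-((h + u * Complex.I) * N)) * complexMGF Y P (h + u * Complex.I)) =
      ∫ ω, f u ω ∂P := by
    intro u
    rw [hf]
    simp only
    rw [integral_const_mul, integral_const_mul, complexMGF]
  simp only [hlhs]
  rw [hswap, ← integral_complex_ofReal, ← integral_const_mul]
  refine integral_congr_ae ?_
  filter_upwards [hYint] with ω ⟨k, hk⟩
  have hin : ∀ u : ℝ, f u ω = Complex.exp ((h * (k - N) : ℝ) : ℂ) *
      (lagSeries w (u * Complex.I) * Complex.exp (((k - N : ℤ) : ℂ) * Complex.I * u)) := by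
    intro u
    rw [hf]
    simp only
    rw [← Complex.exp_add, mul_left_comm, ← Complex.exp_add, hk]
    congr 2
    push_cast
    ring
  simp only [hin]
  -- Only `q = k - N` survives, and nothing if `k < N`; the tilt `e^{h(k-N)}` cancels the `e^{-qh}`
  -- in the weight.
  rw [intervalIntegral.integral_const_mul, integral_lagSeries_mul_exp hsum]
  by_cases hkN : (N : ℤ) ≤ k
  · have hmem : ω ∈ {ω | (N : ℝ) ≤ Y ω} := by
      simp only [Set.mem_ofPred_eq, hk]; exact_mod_cast hkN
    rw [if_pos (by omega), Set.indicator_of_mem hmem, hk]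
    obtain ⟨j, hj⟩ := Int.eq_ofNat_of_zero_le (by omega : 0 ≤ k - N)
    have hj' : (k : ℝ) - N = j := by exact_mod_cast hj
    rw [hj, hj', Int.toNat_natCast, ← Complex.ofReal_exp]
    rw [mul_left_comm]
    congr 1
    rw [← Complex.ofReal_mul, mul_left_comm, ← Real.exp_add]
    congr 1
    rw [show h * (j : ℝ) + -(j * h) = 0 by ring, Real.exp_zero, mul_one]
  · have hmem : ω ∉ {ω | (N : ℝ) ≤ Y ω} := by
      simp only [Set.mem_ofPred_eq, hk]
      intro h'
      exact hkN (by exact_mod_cast h')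
    rw [if_neg (by omega), Set.indicator_of_notMem hmem]
    simp

theorem integrable_overshoot [IsProbabilityMeasure P] (hY : AEMeasurable Y P)
    (hYint : ∀ᵐ ω ∂P, ∃ k : ℤ, Y ω = k) {h : ℝ}
    (hexp : Integrable (fun ω => Real.exp (h * Y ω)) P) {g : ℝ → ℝ} {a b : ℝ} (ha : 0 < a)
    (hb : b < h) (hg : ∀ y : ℝ, 0 ≤ y → |g y| ≤ a * Real.exp (b * y)) (N : ℝ) :
    Integrable (Set.indicator {ω | N ≤ Y ω} fun ω => g (Y ω - N)) P := by
  refine (hexp.const_mul (a * Real.exp (-(h * N)))).mono' ?_ (ae_of_all _ fun ω => ?_)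
  -- No measurability of `g` is needed: almost surely the functional factors through `⌊Y⌋`, and
  -- every function on `ℤ` is measurable.
  · set F : ℤ → ℝ := fun k => if N ≤ (k : ℝ) then g (k - N) else 0 with hF
    have hm : AEMeasurable (fun ω => F ⌊Y ω⌋) P :=
      (measurable_from_top (f := F)).comp_aemeasurable (Int.measurable_floor.comp_aemeasurable hY)
    refine (hm.congr ?_).aestronglyMeasurable
    filter_upwards [hYint] with ω ⟨k, hk⟩
    rw [hk, Int.floor_intCast, hF, Set.indicator_apply]
    simp only [Set.mem_ofPred_eq, hk]
  · by_cases hω : N ≤ Y ω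
    · rw [Set.indicator_of_mem (by exact hω), Real.norm_eq_abs]
      refine (hg _ (by linarith)).trans ?_
      rw [mul_assoc, ← Real.exp_add]
      gcongr
      nlinarith
    · rw [Set.indicator_of_notMem (by exact hω), norm_zero]
      positivity

end Tail

/-! ### Matching the coefficients and the prefactor. -/

theorem taylorCoeff_comp_const_add (f : ℂ → ℂ) (a : ℂ) (n : ℕ) :
    taylorCoeff (fun s => f (a + s)) n = iteratedDeriv n f a / (n.factorial : ℂ) := by
  rw [taylorCoeff, iteratedDeriv_comp_const_add]
  simp

/-- The Taylor coefficients of a function at a point, after subtraction of its tangent. -/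
theorem taylorCoeff_sub_tangent {f : ℂ → ℂ} {a x : ℂ} {r : ℝ} (hr : 0 < r)
    (hf : DifferentiableOn ℂ f (Metric.ball a r)) (hx : deriv f a = x) (n : ℕ) :
    taylorCoeff (fun s => f (a + s) - f a - x * s) n =
      if n < 2 then 0 else iteratedDeriv n f a / (n.factorial : ℂ) := by
  have hg : DifferentiableOn ℂ (fun s => f (a + s)) (Metric.ball 0 r) := by
    refine hf.comp (by fun_prop) fun s hs => ?_
    simpa using hs
  refine taylorCoeff_of_hasSum (a := fun n => if n < 2 then (0 : ℂ) else
    iteratedDeriv n f a / (n.factorial : ℂ)) hr (fun s hs => ?_) n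
  have h := (hasSum_nat_add_iff' 2).mpr (hasSum_taylorCoeff hg hs)
  rw [← hasSum_nat_add_iff' 2]
  simp only [taylorCoeff_comp_const_add, Finset.sum_range_succ, Finset.sum_range_zero] at h ⊢
  convert! h using 1
  simp [hx]
  ring

/-- With `j = i + 1`, the identity `(j+2)! = (j+2)(j+1) j!` merges the factorials, and the factors
`1/η''(h)` in the product supply the missing `σ^(-M)`. -/
theorem faaSum_eq_gaussianFaaSum {η : ℂ → ℂ} {h : ℝ} (hσ : iteratedDeriv 2 η h ≠ 0) (k n : ℕ) :
    faaSum η h k n = gaussianFaaSum (iteratedDeriv 2 η h)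
      (fun i => iteratedDeriv (i + 3) η h / ((i + 3).factorial : ℂ)) k n := by
  refine Finset.sum_congr rfl fun m _ => ?_
  set σ := iteratedDeriv 2 η h
  have hfac : ∀ i : Fin n,
      (1 / σ * (iteratedDeriv ((i : ℕ) + 3) η h / (((i : ℂ) + 3) * ((i : ℂ) + 2)))) ^ m i /
        (((m i).factorial : ℂ) * (((i : ℕ) + 1).factorial : ℂ) ^ m i) =
      (iteratedDeriv ((i : ℕ) + 3) η h / (((i : ℕ) + 3).factorial : ℂ)) ^ m i /
        ((m i).factorial : ℂ) / σ ^ m i := by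
    intro i
    have h1 : (((i : ℕ) + 3).factorial : ℂ) =
        ((i : ℂ) + 3) * ((i : ℂ) + 2) * (((i : ℕ) + 1).factorial : ℂ) := by
      rw [Nat.factorial_succ, Nat.factorial_succ]; push_cast; ring
    rw [h1, mul_comm ((m i).factorial : ℂ), ← div_div, ← div_pow, div_right_comm, ← div_pow]
    congr 2
    rw [one_div_mul_eq_div, div_div, div_div, div_div]
    congr 1
    ring
  have hprod := Finset.prod_congr (rfl : (Finset.univ : Finset (Fin n)) = _) fun i _ => hfac i
  rw [Finset.prod_div_distrib, Finset.prod_div_distrib, Finset.prod_pow_eq_pow_sum] at hprod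
  rw [div_mul_eq_mul_div, mul_div_assoc, hprod, pow_add]
  field_simp

theorem norm_weight_le {g : ℝ → ℝ} {a b h : ℝ}
    (hg : ∀ y : ℝ, 0 ≤ y → |g y| ≤ a * Real.exp (b * y)) (q : ℕ) :
    ‖((g q * Real.exp (-(q * h)) : ℝ) : ℂ)‖ ≤ a * Real.exp (-((h - b) * q)) := by
  rw [Complex.norm_real, norm_mul, Real.norm_eq_abs, Real.norm_of_nonneg (Real.exp_pos _).le]
  calc |g q| * Real.exp (-(q * h)) ≤ a * Real.exp (b * q) * Real.exp (-(q * h)) := by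
        gcongr; exact hg q q.cast_nonneg
    _ = _ := by rw [mul_assoc, ← Real.exp_add]; congr 2; ring

theorem ofReal_gSeries (g : ℝ → ℝ) (h : ℝ) (m : ℕ) :
    (gSeries g h m : ℂ) = ∑' q : ℕ, ((g q * Real.exp (-(q * h)) : ℝ) : ℂ) *
      ((-(q : ℂ)) ^ m / (m.factorial : ℂ)) := by
  rw [gSeries, Complex.ofReal_tsum]
  push_cast
  rfl

theorem coeff_zero (η ψ : ℂ → ℂ) (g : ℝ → ℝ) (h : ℝ) :
    coeff η ψ g h 0 = ((∑' q : ℕ, g q * Real.exp (-(q * h)) : ℝ) : ℂ) * ψ h := by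
  have h1 : faaSum η h 0 0 = 1 := by
    have h2 : faaIndex 0 = {![]} := by
      ext m; simp [mem_faaIndex, Subsingleton.elim m ![]]
    simp [faaSum, h2]
  simp [coeff, h1, gSeries]

/-- Here `1/(2π)` comes from Fourier inversion and `√(2π/(sσ))` from the Gaussian integral. -/
theorem prefactor_eq {φ : Measure ℝ} {η : ℂ → ℂ} {x h s σ : ℝ} (hs : 0 < s) (hσ : 0 < σ)
    (hη : iteratedDeriv 2 η h = σ) :
    prefactor φ η x h s =
      Real.exp (-(s * rateFunction φ x)) / (2 * Real.pi) * √(2 * Real.pi / (s * σ)) := by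
  rw [prefactor, hη, Complex.ofReal_re, div_mul_eq_mul_div, div_eq_div_iff (by positivity)
    (by positivity), mul_assoc, ← Real.sqrt_mul (by positivity)]
  have : 2 * Real.pi / (s * σ) * (2 * Real.pi * s * σ) = (2 * Real.pi) ^ 2 := by field_simp
  rw [this, Real.sqrt_sq (by positivity)]

/-- An integral whose integrand is dominated by a Gaussian weight. -/
theorem norm_integral_le_of_gaussian_bound {f : ℝ → ℂ} {B κ t L : ℝ} (hL : 0 ≤ L) (hκ : 0 < κ)
    (ht : 0 < t) (hB : 0 ≤ B)
    (hf : ∀ u : ℝ, |u| ≤ L → ‖f u‖ ≤ B * Real.exp (-(t * κ * u ^ 2))) :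
    ‖∫ u in (-L)..L, f u‖ ≤ B * (√(2 * Real.pi / (2 * κ)) * (1 / √t)) := by
  have hint : Integrable fun u : ℝ => B * Real.exp (-(t * κ * u ^ 2)) := by
    simpa using (integrable_pow_mul_exp_neg_mul_sq (mul_pos ht hκ) 0).const_mul B
  have h0 := integral_even_pow_mul_exp_neg_scale hκ ht 0
  simp only [mul_zero, pow_zero, one_mul, mul_one, Nat.zero_sub, Nat.doubleFactorial, Nat.cast_one,
    div_one] at h0
  rw [← h0, ← integral_const_mul, intervalIntegral.integral_of_le (by linarith)]
  refine (norm_integral_le_of_norm_le hint.integrableOn ?_).trans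
    (setIntegral_le_integral hint (ae_of_all _ fun u => by positivity))
  refine (ae_restrict_iff' measurableSet_Ioc).mpr (ae_of_all _ fun u hu => ?_)
  exact hf u (abs_le.mpr ⟨hu.1.le, hu.2⟩)

/-! ### The integral representation and the final expansion. -/

section Main

variable {Ω : Type*} [MeasurableSpace Ω] {P : Measure Ω} {X : ℕ → Ω → ℝ} {t : ℕ → ℝ}
  {φ : Measure ℝ} {η ψ : ℂ → ℂ} {c d : EReal}

theorem vertical_mem_strip {h : ℝ} (hh : h ∈ realStrip c d) (u : ℝ) :
    (h + u * Complex.I : ℂ) ∈ strip c d := by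
  rw [mem_strip_iff]; simpa using hh

theorem continuous_comp_vertical {f : ℂ → ℂ} (hf : ContinuousOn f (strip c d)) {h : ℝ}
    (hh : h ∈ realStrip c d) : Continuous fun u : ℝ => f (h + u * Complex.I) :=
  hf.comp_continuous (by fun_prop) (vertical_mem_strip hh)

theorem complexMGF_eq_exp_mul_renormalized (n : ℕ) (z : ℂ) :
    complexMGF (X n) P z = Complex.exp (t n * η z) * renormalized P X t η n z := by
  rw [renormalized, ← mul_assoc, ← Complex.exp_add, add_neg_cancel, Complex.exp_zero, one_mul,
    complexMGF]

theorem continuousOn_renormalized (H : ConvergesModPhi P X t φ η ψ c d) (n : ℕ) :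
    ContinuousOn (renormalized P X t η n) (strip c d) := by
  have h1 : ContinuousOn (complexMGF (X n) P) (strip c d) :=
    differentiableOn_complexMGF.continuousOn.mono fun z hz =>
      realStrip_subset_interior (H.integrable n) hz
  exact (continuousOn_const.mul H.exponent.holomorphic.continuousOn).neg.cexp.mul h1

/-- The exact integral representation of the tail functional at a lattice point. -/
theorem integral_tail_eq [IsProbabilityMeasure P] (hX : ∀ n, AEMeasurable (X n) P)
    (H : ConvergesModPhi P X t φ η ψ c d) (hXint : ∀ n, ∀ᵐ ω ∂P, ∃ k : ℤ, X n ω = k)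
    {h x : ℝ} (hh : h ∈ realStrip c d) (hx : deriv η h = (x : ℂ)) {g : ℝ → ℝ}
    (hsum : Summable fun q : ℕ => ‖((g q * Real.exp (-(q * h)) : ℝ) : ℂ)‖) (n N : ℕ)
    (hN : t n * x = N) :
    ((∫ ω, tail X t x g n ω ∂P : ℝ) : ℂ) =
      ((Real.exp (-(t n * rateFunction φ x)) / (2 * Real.pi) : ℝ) : ℂ) *
        ∫ u in (-Real.pi)..Real.pi,
          lagSeries (fun q => ((g q * Real.exp (-(q * h)) : ℝ) : ℂ)) (u * Complex.I) *
            renormalized P X t η n (h + u * Complex.I) *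
            Complex.exp (t n * (η (h + u * Complex.I) - η h - x * (u * Complex.I))) := by
  have h1 := integral_lagSeries_mul_complexMGF (hX n) (hXint n) (H.integrable n h hh.1 hh.2)
    hsum N
  have h2 : (∫ ω, tail X t x g n ω ∂P) =
      ∫ ω, Set.indicator {ω | (N : ℝ) ≤ X n ω} (fun ω => g (X n ω - N)) ω ∂P := by
    simp only [tail, hN]
  have hη := H.exponent.apply_ofReal hh
  have hNc : (N : ℂ) = t n * x := by rw [← Complex.ofReal_mul, hN]; simp
  have h3 : ∀ u : ℝ,
      lagSeries (fun q => ((g q * Real.exp (-(q * h)) : ℝ) : ℂ)) (u * Complex.I) *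
          (Complex.exp (-((h + u * Complex.I) * N)) * complexMGF (X n) P (h + u * Complex.I)) =
        (Real.exp (-(t n * rateFunction φ x)) : ℂ) *
          (lagSeries (fun q => ((g q * Real.exp (-(q * h)) : ℝ) : ℂ)) (u * Complex.I) *
            renormalized P X t η n (h + u * Complex.I) *
            Complex.exp (t n * (η (h + u * Complex.I) - η h - x * (u * Complex.I)))) := by
    intro u
    have h4 : Complex.exp (-((h + u * Complex.I) * N)) *
        Complex.exp (t n * η (h + u * Complex.I)) =
        (Real.exp (-(t n * rateFunction φ x)) : ℂ) *
          Complex.exp (t n * (η (h + u * Complex.I) - η h - x * (u * Complex.I))) := by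
      rw [H.exponent.rateFunction_eq hh hx, Complex.ofReal_exp, ← Complex.exp_add,
        ← Complex.exp_add, hNc, hη]
      congr 1
      push_cast
      ring
    rw [complexMGF_eq_exp_mul_renormalized (t := t) (η := η), ← mul_assoc (Complex.exp (-_)), h4]
    ring
  simp only [h3] at h1
  rw [intervalIntegral.integral_const_mul, ← h2] at h1
  have hpi : (2 * Real.pi : ℂ) ≠ 0 := by exact_mod_cast Real.two_pi_pos.ne'
  refine mul_left_cancel₀ hpi ?_
  have hcancel : (2 * Real.pi : ℂ) *
      ((Real.exp (-(t n * rateFunction φ x)) / (2 * Real.pi) : ℝ) : ℂ) =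
      (Real.exp (-(t n * rateFunction φ x)) : ℂ) := by
    rw [Complex.ofReal_div, Complex.ofReal_mul, Complex.ofReal_ofNat, mul_div_cancel₀ _ hpi]
  rw [← h1, ← hcancel, mul_assoc]

/-- The full asymptotic expansion of the tail functional along lattice points. -/
theorem exists_tail_expansion_bound [IsProbabilityMeasure P] (hX : ∀ n, AEMeasurable (X n) P)
    (H : ConvergesModPhi P X t φ η ψ c d) {v : ℕ} (hspeed : HasSpeed P X t η ψ c d v)
    (hφ : HasMinimalLatticeInt φ) (hXint : ∀ n, ∀ᵐ ω ∂P, ∃ k : ℤ, X n ω = k)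
    {h x : ℝ} (hh : h ∈ realStrip c d) (hx : deriv η h = (x : ℂ)) {g : ℝ → ℝ} {a b : ℝ}
    (hb : b < h) (hg : ∀ y : ℝ, 0 ≤ y → |g y| ≤ a * Real.exp (b * y)) :
    ∃ C : ℝ, ∀ᶠ n in atTop, (∃ k : ℕ, t n * x = k) →
      ‖((∫ ω, tail X t x g n ω ∂P : ℝ) : ℂ) - (prefactor φ η x h (t n) : ℂ) *
          ∑ k ∈ Finset.range v, coeff η ψ g h k / (t n : ℂ) ^ k‖ ≤
        prefactor φ η x h (t n) * (C / t n ^ v) := by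
  have hexpo := H.exponent
  set w : ℕ → ℂ := fun q => ((g q * Real.exp (-(q * h)) : ℝ) : ℂ) with hw
  have hδ : 0 < h - b := by linarith
  have hwle : ∀ q, ‖w q‖ ≤ a * Real.exp (-((h - b) * q)) := norm_weight_le hg
  have hsum := summable_norm_of_exp_bound hδ hwle
  obtain ⟨r₁, hr₁, hball⟩ := Metric.isOpen_iff.mp (isOpen_strip c d) _ (ofReal_mem_strip hh)
  -- `r₁` keeps the disc around `h` inside the strip, for `η` and `ψ`; `h - b` is the decay rate of
  -- the weights, hence a radius on which the Taylor series of `G` converges.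
  set r := min r₁ (h - b) with hr
  have hr0 : 0 < r := lt_min hr₁ hδ
  set σ := iteratedDeriv 2 (cgf id φ) h with hσdef
  have hσ : 0 < σ := hexpo.iteratedDeriv_two_pos hh
  have hση : iteratedDeriv 2 η h = (σ : ℂ) := hexpo.iteratedDeriv_two_ofReal hh
  have hshift : ∀ f : ℂ → ℂ, DifferentiableOn ℂ f (strip c d) →
      DifferentiableOn ℂ (fun s => f (h + s)) (Metric.ball 0 r) := by
    intro f hf
    refine hf.comp (by fun_prop) fun s hs => hball ?_
    have : ‖s‖ < r := by simpa using hs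
    simpa using this.trans_le (min_le_left _ _)
  have hηball : DifferentiableOn ℂ η (Metric.ball h r) := hexpo.holomorphic.mono
    ((Metric.ball_subset_ball (min_le_left _ _)).trans hball)
  set Φ : ℂ → ℂ := fun s => η (h + s) - η h - x * s with hΦdef
  have hΦ : DifferentiableOn ℂ Φ (Metric.ball 0 r) :=
    ((hshift η hexpo.holomorphic).sub_const _).sub (by fun_prop)
  have hΦc : ∀ n, taylorCoeff Φ n = if n < 2 then 0 else
      iteratedDeriv n η h / (n.factorial : ℂ) := taylorCoeff_sub_tangent hr0 hηball hx
  have h0 : taylorCoeff Φ 0 = 0 := by simp [hΦc]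
  have h1 : taylorCoeff Φ 1 = 0 := by simp [hΦc]
  have h2 : taylorCoeff Φ 2 = (σ : ℂ) / 2 := by simp [hΦc, hση]
  have hΦ3 : (fun i => taylorCoeff Φ (i + 3)) =
      fun i => iteratedDeriv (i + 3) η h / ((i + 3).factorial : ℂ) := by
    funext i; rw [hΦc, if_neg (by omega)]
  set Ψ : ℂ → ℂ := fun s => ψ (h + s) with hΨdef
  have hΨ : DifferentiableOn ℂ Ψ (Metric.ball 0 r) := hshift ψ H.analytic.differentiableOn
  have hGsum : ∀ s : ℂ, ‖s‖ < r →
      HasSum (fun m => (gSeries g h m : ℂ) * s ^ m) (lagSeries w s) := by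
    intro s hs
    simp only [ofReal_gSeries]
    exact hasSum_lagSeries hwle (hs.trans_le (min_le_right _ _))
  have hG := differentiableOn_of_hasSum hr0 hGsum
  have hcoeff : ∀ k, coeff η ψ g h k = ∑ p ∈ Finset.HasAntidiagonal.antidiagonal (2 * k),
      ∑ r ∈ Finset.HasAntidiagonal.antidiagonal p.2,
        taylorCoeff (lagSeries w) p.1 * taylorCoeff Ψ r.1 *
          gaussianFaaSum σ (fun i => taylorCoeff Φ (i + 3)) k r.2 := by
    intro k
    refine Finset.sum_congr rfl fun p _ => Finset.sum_congr rfl fun q _ => ?_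
    rw [taylorCoeff_of_hasSum hr0 hGsum, hΨdef, taylorCoeff_comp_const_add, hΦ3, ← hση,
      faaSum_eq_gaussianFaaSum (by rw [hση]; exact_mod_cast hσ.ne')]
  have hGcont := continuous_lagSeries_mul_I hsum
  have hΨcont : Continuous fun u : ℝ => Ψ (u * Complex.I) :=
    continuous_comp_vertical H.analytic.continuousOn hh
  have hΦcont : Continuous fun u : ℝ => Φ (u * Complex.I) :=
    ((continuous_comp_vertical hexpo.holomorphic.continuousOn hh).sub continuous_const).sub
      (by fun_prop)
  have hηre : ((η h).re : ℝ) = cgf id φ h := by rw [hexpo.apply_ofReal hh, Complex.ofReal_re]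
  have hneg : ∀ u : ℝ, u ≠ 0 → |u| ≤ Real.pi → (Φ (u * Complex.I)).re < 0 := by
    intro u hu huπ
    have h3 := hexpo.re_lt_of_minimalLattice hφ hh hu huπ
    simp only [hΦdef, Complex.sub_re, hηre]
    simp
    exact h3
  obtain ⟨κ, hκ, hκσ, hre⟩ := exists_re_phase_le hr0 hσ hΦ h0 h1 h2 Real.pi_pos
    hΦcont.continuousOn hneg
  obtain ⟨C₁, hC₁⟩ := laplace_expansion hr0 hσ hG hΨ hΦ h0 h1 h2 Real.pi_pos
    hGcont.continuousOn hΨcont.continuousOn hΦcont.continuousOn hκ hκσ hre v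
  obtain ⟨C₂, hC₂, hC₂ev⟩ := hspeed ((fun u : ℝ => (h + u * Complex.I : ℂ)) ''
    Set.Icc (-Real.pi) Real.pi) (isCompact_Icc.image (by fun_prop))
    (by rintro _ ⟨u, -, rfl⟩; exact vertical_mem_strip hh u)
  set B := ∑' q, ‖w q‖ with hBdef
  have hB : 0 ≤ B := tsum_nonneg fun _ => norm_nonneg _
  set D := C₁ + B * C₂ * √(2 * Real.pi / (2 * κ)) with hD
  -- The errors are bounded by `D / (√t t^v)`; dividing by `√(2π/σ)` expresses them relative to the
  -- prefactor, which contains `√(2π/(tσ))`.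
  refine ⟨D / √(2 * Real.pi / σ), ?_⟩
  filter_upwards [hC₂ev, H.tendsto_param.eventually_gt_atTop 0] with n hn htn
  rintro ⟨N, hN⟩
  have hren : Continuous fun u : ℝ => renormalized P X t η n (h + u * Complex.I) :=
    continuous_comp_vertical (continuousOn_renormalized H n) hh
  have hE : Continuous fun u : ℝ => Complex.exp (t n * Φ (u * Complex.I)) :=
    (continuous_const.mul hΦcont).cexp
  set I₁ := ∫ u in (-Real.pi)..Real.pi, lagSeries w (u * Complex.I) * Ψ (u * Complex.I) *
    Complex.exp (t n * Φ (u * Complex.I)) with hI₁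
  set I₂ := ∫ u in (-Real.pi)..Real.pi, lagSeries w (u * Complex.I) *
    (renormalized P X t η n (h + u * Complex.I) - Ψ (u * Complex.I)) *
    Complex.exp (t n * Φ (u * Complex.I)) with hI₂
  -- Split `ψ_n = ψ + (ψ_n - ψ)`: Laplace's method handles `I₁`, and the speed of convergence on the
  -- vertical segment over `h` handles `I₂`.
  have hrepr : ((∫ ω, tail X t x g n ω ∂P : ℝ) : ℂ) =
      ((Real.exp (-(t n * rateFunction φ x)) / (2 * Real.pi) : ℝ) : ℂ) * (I₁ + I₂) := by
    have hi₁ : Continuous fun u : ℝ => lagSeries w (u * Complex.I) * Ψ (u * Complex.I) *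
      Complex.exp (t n * Φ (u * Complex.I)) := (hGcont.mul hΨcont).mul hE
    have hi₂ : Continuous fun u : ℝ => lagSeries w (u * Complex.I) *
      (renormalized P X t η n (h + u * Complex.I) - Ψ (u * Complex.I)) *
      Complex.exp (t n * Φ (u * Complex.I)) := (hGcont.mul (hren.sub hΨcont)).mul hE
    rw [integral_tail_eq hX H hXint hh hx hsum n N hN, hI₁, hI₂,
      ← intervalIntegral.integral_add (hi₁.intervalIntegrable _ _) (hi₂.intervalIntegrable _ _)]
    congr 1
    refine intervalIntegral.integral_congr fun u _ => ?_
    simp only [hΦdef]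
    ring
  have hI₂le : ‖I₂‖ ≤ B * C₂ * √(2 * Real.pi / (2 * κ)) * (1 / (√(t n) * t n ^ v)) := by
    have h3 := norm_integral_le_of_gaussian_bound (f := fun u : ℝ => lagSeries w (u * Complex.I) *
      (renormalized P X t η n (h + u * Complex.I) - Ψ (u * Complex.I)) *
      Complex.exp (t n * Φ (u * Complex.I))) (B := B * (C₂ / t n ^ v)) Real.pi_pos.le hκ htn
      (by positivity) fun u hu => by
        rw [norm_mul, norm_mul, Complex.norm_exp, Complex.re_ofReal_mul]
        have h4 := hn _ ⟨u, abs_le.mp hu, rfl⟩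
        have h5 : t n * (Φ (u * Complex.I)).re ≤ -(t n * κ * u ^ 2) := by
          have := mul_le_mul_of_nonneg_left (hre u hu) htn.le
          linarith
        exact mul_le_mul (mul_le_mul (norm_lagSeries_mul_I_le hsum u) h4 (norm_nonneg _) hB)
          (Real.exp_le_exp.mpr h5) (Real.exp_pos _).le (by positivity)
    refine h3.trans (le_of_eq ?_)
    have : √(t n) ≠ 0 := by positivity
    field_simp
  have hmain := hC₁ (t n) htn
  simp only [← hcoeff] at hmain
  rw [prefactor_eq htn hσ hση]
  have hsqrt : √(2 * Real.pi / (t n * σ)) = √(2 * Real.pi / σ) / √(t n) := by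
    rw [← Real.sqrt_div' _ htn.le]; congr 1; field_simp
  set e := Real.exp (-(t n * rateFunction φ x)) / (2 * Real.pi) with he
  have he0 : 0 ≤ e := by positivity
  rw [hrepr, Complex.ofReal_mul, mul_assoc, ← mul_sub, norm_mul, Complex.norm_real,
    Real.norm_of_nonneg he0, mul_assoc]
  refine mul_le_mul_of_nonneg_left ?_ he0
  calc _ ≤ ‖I₁ - (√(2 * Real.pi / (t n * σ)) : ℂ) *
        ∑ k ∈ Finset.range v, coeff η ψ g h k / (t n : ℂ) ^ k‖ + ‖I₂‖ := by
        rw [add_sub_right_comm]; exact norm_add_le _ _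
    _ ≤ D * (1 / (√(t n) * t n ^ v)) := by
        rw [hD, add_mul]; exact add_le_add hmain hI₂le
    _ = _ := by
        have h6 : √(2 * Real.pi / σ) ≠ 0 := by positivity
        have h7 : √(t n) ≠ 0 := by positivity
        rw [hsqrt]
        field_simp

end Main

end ModPhi

end

theorem proposition4p3
    {Ω : Type*} [MeasurableSpace Ω] (P : Measure Ω) [IsProbabilityMeasure P]
    (X : ℕ → Ω → ℝ) (hX : ∀ n, AEMeasurable (X n) P)
    (t : ℕ → ℝ) (φ : Measure ℝ) (η ψ : ℂ → ℂ) (c d : EReal) (hc : c < 0) (hd : 0 < d)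
    (v : ℕ) (hv : 1 ≤ v)
    (hconv : ModPhi.ConvergesModPhi P X t φ η ψ c d)
    (hspeed : ModPhi.HasSpeed P X t η ψ c d v)
    (hφ : ModPhi.HasMinimalLatticeInt φ)
    (hXint : ∀ n, ∀ᵐ ω ∂P, ∃ k : ℤ, X n ω = k)
    (x : ℝ) (hx0 : (deriv η 0).re < x) (hxd : (x : EReal) < ModPhi.derivAtRightEnd η d) :
    (∃! h : ℝ, (c < (h : EReal) ∧ (h : EReal) < d) ∧ deriv η (h : ℂ) = (x : ℂ)) ∧
    ∀ h : ℝ, c < (h : EReal) → (h : EReal) < d → deriv η (h : ℂ) = (x : ℂ) →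
      ∀ (g : ℝ → ℝ) (a b : ℝ), 0 < a → b < h → (∀ y : ℝ, 0 ≤ y → |g y| ≤ a * Real.exp (b * y)) →
        (∀ n, Integrable (ModPhi.tail X t x g n) P) ∧
        (∀ m : ℕ, Summable fun q : ℕ =>
          g q * Real.exp (-(q * h)) * ((-(q : ℝ)) ^ m / (m.factorial : ℝ))) ∧
        ModPhi.coeff η ψ g h 0 = ((∑' q : ℕ, g q * Real.exp (-(q * h)) : ℝ) : ℂ) * ψ h ∧
        ∃ C : ℝ, ∀ᶠ n in atTop, (∃ k : ℕ, t n * x = k) →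
          ‖((∫ ω, ModPhi.tail X t x g n ω ∂P : ℝ) : ℂ) -
              (ModPhi.prefactor φ η x h (t n) : ℂ) *
                ∑ k ∈ Finset.range v, ModPhi.coeff η ψ g h k / (t n : ℂ) ^ k‖ ≤
            ModPhi.prefactor φ η x h (t n) * (C / t n ^ v) := by
  refine ⟨hconv.exponent.existsUnique_deriv_eq hc hd hx0 hxd,
    fun h hch hhd hx g a b ha hb hg => ⟨fun n => ?_, fun m => ?_, ModPhi.coeff_zero η ψ g h,
      ModPhi.exists_tail_expansion_bound hX hconv hspeed hφ hXint ⟨hch, hhd⟩ hx hb hg⟩⟩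
  · exact ModPhi.integrable_overshoot (hX n) (hXint n) (hconv.integrable n h hch hhd) ha hb hg _
  · have h1 := ModPhi.summable_lag_moment (sub_pos.mpr hb) (ModPhi.norm_weight_le hg) m
    rw [← Complex.summable_ofReal]
    convert! h1 using 2 with q
    push_cast
    ring
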